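/- Let $\mathbf X_1,\dots,\mathbf X_N\in\mathbb Q^{m\times n}$ be quaternion matrices, $y_1,\dots,y_N\in\{-1,1\}$, and $C,\lambda,\rho>0$, $\tau\in(0,1.618]$. Write $\langle\mathbf X,\mathbf Y\rangle=\mathrm{Tr}(\mathbf X^*\mathbf Y)$, $\|\cdot\|_F$ for the Frobenius norm and $\|\cdot\|_{Q,*}$ for the quaternion nuclear norm (the sum of the singular values in a quaternion singular value decomposition). The LSQMM model is $$\min_{\mathbf W\in\mathbb Q^{m\times n},\,b\in\mathbb R,\,\xi\in\mathbb R^N}\ \tfrac12\|\mathbf W\|_F^2+\lambda\|\mathbf W\|_{Q,*}+C\sum_{i=1}^N\xi_i\quad\text{s.t.}\quad y_i(\mathrm{Re}\langle\mathbf W,\mathbf X_i\rangle+b)\ge 1-\xi_i,\ \ \xi_i\ge0\quad(i=1,\dots,N).$$ Call $(\mathbf W,b)$ a solution if it is optimal together with some $\xi$. Put $$f(\mathbf W,b,\mathbf Z)=\tfrac12\|\mathbf W\|_F^2+\lambda\|\mathbf Z\|_{Q,*}+C\sum_{i=1}^N\max\{0,\,1-y_i(\mathrm{Re}\langle\mathbf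 W,\mathbf X_i\rangle+b)\},$$ $$L_\rho(\mathbf W,b,\mathbf Z,\mathbf U)=f(\mathbf W,b,\mathbf Z)-\mathrm{Re}\langle\mathbf U,\mathbf W-\mathbf Z\rangle+\tfrac\rho2\|\mathbf W-\mathbf Z\|_F^2 ,$$ and let $L_0$ be the same expression with $\rho=0$. Consider the quaternion ADMM: $\mathbf W^0=\mathbf Z^0=\mathbf U^0=\mathbf 0$, $b^0=0$, and for $k=0,1,2,\dots$ (without stopping): 1. Let $\alpha^{k+1}$ be any optimal solution of $$\max_{\alpha\in\mathbb R^N}\ \sum_{i=1}^N\Big(1-\frac{y_i\,\mathrm{Re}\langle\mathbf U^k+\rho\mathbf Z^k,\mathbf X_i\rangle}{\rho+1}\Big)\alpha_i-\frac1{2(1+\rho)}\Big\|\sum_{i=1}^N\alpha_iy_i\mathbf X_i\Big\|_F^2\quad\text{s.t.}\quad\sum_{i=1}^N\alpha_iy_i=0,\ \ 0\le\alpha_i\le C,$$ and set $\mathbf W^{k+1}=\frac1{1+\rho}\big(\rho\mathbf Z^k+\mathbf U^k+\sum_i\alpha_i^{k+1}y_i\mathbf X_i\big)$. Let $S^{k+1}=\{i:0<\alpha_i^{k+1}<C\}$.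 If $S^{k+1}\neq\emptyset$, set $b^{k+1}=\frac1{|S^{k+1}|}\sum_{i\in S^{k+1}}(y_i-\mathrm{Re}\langle\mathbf W^{k+1},\mathbf X_i\rangle)$; if $S^{k+1}=\emptyset$, let $b^{k+1}$ be any number such that $(\mathbf W^{k+1},b^{k+1})$ minimizes $L_\rho(\cdot,\cdot,\mathbf Z^k,\mathbf U^k)$. 2. $\mathbf Z^{k+1}=\operatorname{Prox}_{\frac\lambda\rho\|\cdot\|_{Q,*}}\big(\mathbf W^{k+1}-\tfrac1\rho\mathbf U^k\big)$, that is, a minimizer over $\mathbf Z$ of $\tfrac\lambda\rho\|\mathbf Z\|_{Q,*}+\tfrac12\|\mathbf Z-(\mathbf W^{k+1}-\tfrac1\rho\mathbf U^k)\|_F^2$. 3. $\mathbf U^{k+1}=\mathbf U^k-\tau\rho(\mathbf W^{k+1}-\mathbf Z^{k+1})$. Then, for all sequences generated in this way, the iteration converges to an optimal solution of the LSQMM model in the following sense. There are $\overline{\mathbf W},\overline{\mathbf U}\in\mathbb Q^{m\times n}$ such that: (a) the model has a solution of the form $(\overline{\mathbf W},b)$, and every solution has weight matrix $\overline{\mathbf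 W}$; denote by $B$ the nonempty set of all $b$ for which $(\overline{\mathbf W},b)$ is a solution; (b) $\mathbf W^k\to\overline{\mathbf W}$, $\mathbf Z^k\to\overline{\mathbf W}$ and $\mathbf U^k\to\overline{\mathbf U}$; (c) for every $b\in B$, $(\overline{\mathbf W},b,\overline{\mathbf W})$ minimizes $L_0(\cdot,\cdot,\cdot,\overline{\mathbf U})$ over all $(\mathbf W_1,b_1,\mathbf Z_1)$ (so $\overline{\mathbf U}$ is an optimal Lagrange multiplier), and $f(\mathbf W^k,b^k,\mathbf Z^k)\to f(\overline{\mathbf W},b,\overline{\mathbf W})$, the optimal value; (d) $\operatorname{dist}(b^k,B)\to0$; (e) if $S^{k+1}\ne\emptyset$ for infinitely many $k$, then $B$ consists of a single point $\overline b$ and $b^k\to\overline b$, so that $(\mathbf W^k,b^k)$ converges to the unique solution $(\overline{\mathbf W},\overline b)$. -/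

import Mathlib

open Filter Topology
open scoped Quaternion Matrix

namespace LSQMM

/-- Quaternion matrices of size `m × n`. -/
abbrev QMat (m n : ℕ) := Matrix (Fin m) (Fin n) ℍ[ℝ]

/-- The inner product `⟨X, Y⟩ = Tr (X* Y)` (a quaternion). -/
noncomputable def qInner {m n : ℕ} (X Y : QMat m n) : ℍ[ℝ] := (Xᴴ * Y).trace

/-- The Frobenius norm; `‖A i j‖` is the modulus of the quaternion `A i j`. -/
noncomputable def frobNorm {m n : ℕ} (A : QMat m n) : ℝ :=
  Real.sqrt (∑ i, ∑ j, ‖A i j‖ ^ 2)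

/-- The rectangular diagonal matrix with real diagonal entries `σ 0, σ 1, …`. -/
noncomputable def rectDiag (m n : ℕ) (σ : ℕ → ℝ) : QMat m n :=
  Matrix.of fun i j => if (i : ℕ) = (j : ℕ) then ((σ i : ℝ) : ℍ[ℝ]) else 0

/-- `A = U Σ V*` is a quaternion singular value decomposition: `U`, `V` are unitary quaternion
matrices and `Σ` is rectangular diagonal with nonnegative real entries. -/
structure IsQSVD {m n : ℕ} (A : QMat m n) (U : QMat m m) (σ : ℕ → ℝ) (V : QMat n n) : Prop where
  left_unitary : Uᴴ * U = 1 ∧ U * Uᴴ = 1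
  right_unitary : Vᴴ * V = 1 ∧ V * Vᴴ = 1
  nonneg : ∀ i, 0 ≤ σ i
  eq : A = U * rectDiag m n σ * Vᴴ

/-- The nuclear norm: the sum of the singular values (the zero ones contribute nothing).
Every quaternion matrix has a singular value decomposition and the singular values do not depend
on the decomposition, so the set below has exactly one element. -/
noncomputable def nuclearNorm {m n : ℕ} (A : QMat m n) : ℝ :=
  sSup {s : ℝ | ∃ (U : QMat m m) (σ : ℕ → ℝ) (V : QMat n n),
    IsQSVD A U σ V ∧ s = ∑ i ∈ Finset.range (min m n), σ i}

/-- Training samples `X i`, labels `y i` and the penalty parameters `C` and `λ`. -/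
structure Data (m n N : ℕ) where
  X : Fin N → QMat m n
  y : Fin N → ℝ
  C : ℝ
  lam : ℝ

variable {m n N : ℕ}

/-- The value `Re ⟨W, X i⟩ + b` of the decision function at the `i`-th sample. -/
noncomputable def decision (D : Data m n N) (W : QMat m n) (b : ℝ) (i : Fin N) : ℝ :=
  (qInner W (D.X i)).re + b

/-- The constraints of the LSQMM model. -/
def IsFeasible (D : Data m n N) (W : QMat m n) (b : ℝ) (ξ : Fin N → ℝ) : Prop :=
  ∀ i, D.y i * decision D W b i ≥ 1 - ξ i ∧ 0 ≤ ξ i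

/-- The objective of the LSQMM model. -/
noncomputable def objective (D : Data m n N) (W : QMat m n) (ξ : Fin N → ℝ) : ℝ :=
  1 / 2 * frobNorm W ^ 2 + D.lam * nuclearNorm W + D.C * ∑ i, ξ i

/-- `(W, b)`, together with suitable slack variables `ξ`, is an optimal solution of the
LSQMM model. -/
def IsSolution (D : Data m n N) (W : QMat m n) (b : ℝ) : Prop :=
  ∃ ξ : Fin N → ℝ, IsFeasible D W b ξ ∧
    ∀ (W' : QMat m n) (b' : ℝ) (ξ' : Fin N → ℝ), IsFeasible D W' b' ξ' →
      objective D W ξ ≤ objective D W' ξ'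

/-- The objective `f(W, b, Z)` of the split hinge-loss problem with constraint `W = Z`. -/
noncomputable def splitObjective (D : Data m n N) (W : QMat m n) (b : ℝ) (Z : QMat m n) : ℝ :=
  1 / 2 * frobNorm W ^ 2 + D.lam * nuclearNorm Z
    + D.C * ∑ i, max 0 (1 - D.y i * decision D W b i)

/-- The augmented Lagrangian `L_ρ(W, b, Z, U)`; for `ρ = 0` it is the Lagrangian. -/
noncomputable def augLagrangian (D : Data m n N) (ρ : ℝ)
    (W : QMat m n) (b : ℝ) (Z U : QMat m n) : ℝ :=
  splitObjective D W b Z - (qInner U (W - Z)).re + ρ / 2 * frobNorm (W - Z) ^ 2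

/-- The objective of the dual quadratic program of the `(W, b)`-subproblem. -/
noncomputable def dualObjective (D : Data m n N) (ρ : ℝ) (Z U : QMat m n) (α : Fin N → ℝ) : ℝ :=
  ∑ i, (1 - D.y i * (qInner (U + ρ • Z) (D.X i)).re / (ρ + 1)) * α i
    - 1 / (2 * (1 + ρ)) * frobNorm (∑ i, (α i * D.y i) • D.X i) ^ 2

/-- The constraints of the dual quadratic program. -/
def IsDualFeasible (D : Data m n N) (α : Fin N → ℝ) : Prop :=
  ∑ i, α i * D.y i = 0 ∧ ∀ i, 0 ≤ α i ∧ α i ≤ D.C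

/-- `α` is an optimal solution of the dual quadratic program. -/
def IsDualSolution (D : Data m n N) (ρ : ℝ) (Z U : QMat m n) (α : Fin N → ℝ) : Prop :=
  IsDualFeasible D α ∧
    ∀ α', IsDualFeasible D α' → dualObjective D ρ Z U α' ≤ dualObjective D ρ Z U α

/-- The index set of the support matrices. -/
noncomputable def supportSet (D : Data m n N) (α : Fin N → ℝ) : Finset (Fin N) :=
  Finset.univ.filter fun i => 0 < α i ∧ α i < D.C

/-- `Z` is the value at `V` of the proximal operator of `κ` times the nuclear norm. -/
def IsNuclearProx (κ : ℝ) (V Z : QMat m n) : Prop :=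
  ∀ Z' : QMat m n, κ * nuclearNorm Z + 1 / 2 * frobNorm (Z - V) ^ 2
    ≤ κ * nuclearNorm Z' + 1 / 2 * frobNorm (Z' - V) ^ 2

/-- Iterates of the quaternion ADMM with penalty `ρ` and dual step size `τ`; `α (k + 1)` is the
optimal solution of the dual quadratic program that is used to compute `W (k + 1)`, `b (k + 1)`.
The averaging formula for the bias makes sense only if there is a support matrix. If there is none,
the bias is any value that solves the `(W, b)`-subproblem of the ADMM together with `W (k + 1)`. -/
structure IsADMMRun (D : Data m n N) (ρ τ : ℝ) (α : ℕ → Fin N → ℝ)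
    (W : ℕ → QMat m n) (b : ℕ → ℝ) (Z U : ℕ → QMat m n) : Prop where
  W_zero : W 0 = 0
  b_zero : b 0 = 0
  Z_zero : Z 0 = 0
  U_zero : U 0 = 0
  dual_step : ∀ k, IsDualSolution D ρ (Z k) (U k) (α (k + 1))
  W_step : ∀ k, W (k + 1) =
    (1 / (1 + ρ)) • (ρ • Z k + U k + ∑ i, (α (k + 1) i * D.y i) • D.X i)
  b_step : ∀ k, (supportSet D (α (k + 1))).Nonempty → b (k + 1) =
    1 / ((supportSet D (α (k + 1))).card : ℝ)
      * ∑ i ∈ supportSet D (α (k + 1)), (D.y i - (qInner (W (k + 1)) (D.X i)).re)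
  b_step_of_empty : ∀ k, supportSet D (α (k + 1)) = ∅ → ∀ (W' : QMat m n) (b' : ℝ),
    augLagrangian D ρ (W (k + 1)) (b (k + 1)) (Z k) (U k) ≤ augLagrangian D ρ W' b' (Z k) (U k)
  Z_step : ∀ k, IsNuclearProx (D.lam / ρ) (W (k + 1) - (1 / ρ) • U k) (Z (k + 1))
  U_step : ∀ k, U (k + 1) = U k - (τ * ρ) • (W (k + 1) - Z (k + 1))

end LSQMM

/-! The bias can be eliminated. Minimizing the hinge loss over `b` leaves a convex function
`lossMin` of the weight matrix, so the iteration is a two-block ADMM for `lossMin D W + ‖W‖² / 2 + λ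
‖Z‖_*` subject to `W = Z`, in the Euclidean space of quaternion matrices with inner product Re⟨·,·⟩.

Each computed pair (W, b) minimizes its subproblem exactly. If a support matrix exists, optimality
of α gives complementary slackness (`IsDualSolution.isBiasCertificate`), and this certifies the pair
by weak duality (`IsBiasCertificate.augLagrangian_le`); otherwise the rule for the bias demands it.

For a saddle point (x, u), the quantity ‖U - u‖² / (τρ) + ρ‖Z - x‖² + ρ(1 - τ)²‖W - Z‖² drops in
each step after the first by at least 2‖W - x‖² + ρ(1 + τ - τ²)‖W - Z‖² (`lyapunov_decrease`). Hence
W and Z tend to x and U stays bounded. A cluster point of U is again an optimal multiplier, and the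
same monotone quantity taken at that multiplier forces U to converge (`admm_tendsto`).

For fixed weights the hinge loss is piecewise affine in `b` with integer slopes, so it grows at
least as fast as the distance to its minimizers (`hingeSum_add_infDist_le`). Since it is Lipschitz
in the weights, the biases approach B. If B had two points, every margin at their midpoint would be
strict, also for nearby weights, and all multipliers would be 0 or C
(`not_two_argmin_of_certificate`).

Convexity of the nuclear norm comes from writing it as a maximum of linear functionals. This rests
on the existence of a quaternion SVD, obtained by maximizing a weighted trace over pairs of unitary
matrices (`exists_isQSVD`). -/

namespace LSQMM

/-! ### Saddle points and ADMM in a Euclidean space. -/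

section Convex

variable {E : Type*} [NormedAddCommGroup E] [InnerProductSpace ℝ E]

open scoped RealInnerProductSpace

/-- A minimizer of a convex function plus a function that is linear up to second order satisfies
the corresponding subgradient inequality. -/
theorem subgradient_of_isMin {f : E → ℝ} (hf : ConvexOn ℝ Set.univ f) {x g : E} {c : ℝ}
    (hmin : ∀ y, f x ≤ f y + ⟪g, y - x⟫ + c * ‖y - x‖ ^ 2) (y : E) :
    f x ≤ f y + ⟪g, y - x⟫ := by
  -- Test minimality at x + t(y - x) and divide by t: the quadratic error keeps a factor t, which
  -- then tends to 0.
  have key : ∀ t ∈ Set.Ioc (0 : ℝ) 1, f x ≤ f y + ⟪g, y - x⟫ + t * (c * ‖y - x‖ ^ 2) := by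
    intro t ht
    have h1 := hmin (x + t • (y - x))
    have h2 : f (x + t • (y - x)) ≤ (1 - t) * f x + t * f y := by
      have := hf.2 (Set.mem_univ x) (Set.mem_univ y) (sub_nonneg.2 ht.2) ht.1.le
        (sub_add_cancel 1 t)
      simp only [smul_eq_mul] at this
      have e : x + t • (y - x) = (1 - t) • x + t • y := by module
      rw [e]
      exact this
    rw [add_sub_cancel_left, inner_smul_right, norm_smul, mul_pow, Real.norm_eq_abs, sq_abs] at h1
    have h3 : t * f x ≤ t * (f y + ⟪g, y - x⟫ + t * (c * ‖y - x‖ ^ 2)) := by nlinarith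
    exact le_of_mul_le_mul_left h3 ht.1
  have hlim : Tendsto (fun t : ℝ => f y + ⟪g, y - x⟫ + t * (c * ‖y - x‖ ^ 2)) (𝓝[>] 0)
      (𝓝 (f y + ⟪g, y - x⟫ + 0 * (c * ‖y - x‖ ^ 2))) :=
    tendsto_nhdsWithin_of_tendsto_nhds (Continuous.tendsto (by fun_prop) 0)
  rw [zero_mul, add_zero] at hlim
  exact ge_of_tendsto hlim (eventually_of_mem (Ioc_mem_nhdsGT one_pos) key)

theorem half_sq_norm_add (x y : E) :
    1 / 2 * ‖y‖ ^ 2 = 1 / 2 * ‖x‖ ^ 2 + ⟪x, y - x⟫ + 1 / 2 * ‖y - x‖ ^ 2 := by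
  rw [norm_sub_sq_real, inner_sub_right, real_inner_self_eq_norm_sq, real_inner_comm]
  ring

/-- Fermat's rule for a sum of two convex functions, the first one continuous. -/
theorem exists_multiplier_of_isMin [CompleteSpace E] {f h : E → ℝ} (hf : ConvexOn ℝ Set.univ f)
    (hfc : Continuous f) (hh : ConvexOn ℝ Set.univ h) {x : E} (hx : ∀ y, f x + h x ≤ f y + h y) :
    ∃ u : E, (∀ y, f x + ⟪u, y - x⟫ ≤ f y) ∧ ∀ y, h x - ⟪u, y - x⟫ ≤ h y := by
  -- Separate the open strict epigraph of `f` from the hypograph of `f x + h x - h`. They are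
  -- disjoint by minimality, and the slope of the separating hyperplane is the multiplier.
  have hs : Convex ℝ {p : E × ℝ | p.1 ∈ Set.univ ∧ f p.1 < p.2} := hf.convex_strict_epigraph
  have hso : IsOpen {p : E × ℝ | p.1 ∈ Set.univ ∧ f p.1 < p.2} := by
    simp only [Set.mem_univ, true_and]
    exact isOpen_lt (by fun_prop) (by fun_prop)
  have hh' : ConcaveOn ℝ Set.univ (fun y => f x + h x - h y) := by
    have := hh.neg.add_const (f x + h x)
    refine this.congr fun y _ => ?_
    simp; ring
  have ht : Convex ℝ {p : E × ℝ | p.1 ∈ Set.univ ∧ p.2 ≤ f x + h x - h p.1} :=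
    hh'.convex_hypograph
  have hd : Disjoint {p : E × ℝ | p.1 ∈ Set.univ ∧ f p.1 < p.2}
      {p : E × ℝ | p.1 ∈ Set.univ ∧ p.2 ≤ f x + h x - h p.1} := by
    rw [Set.disjoint_left]
    rintro ⟨p, r⟩ ⟨-, h1⟩ ⟨-, h2⟩
    have := hx p
    linarith
  obtain ⟨l, c, hl1, hl2⟩ := geometric_hahn_banach_open hs hso ht hd
  have hsplit : ∀ (y : E) (r : ℝ), l (y, r) = l (y, 0) + r * l (0, 1) := by
    intro y r
    have : (y, r) = (y, (0 : ℝ)) + r • ((0 : E), (1 : ℝ)) := by simp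
    rw [this, map_add, map_smul, smul_eq_mul]
  have h0 := hl2 (x, f x) ⟨Set.mem_univ _, by simp⟩
  have hneg : l (0, 1) < 0 := by
    have := hl1 (x, f x + 1) ⟨Set.mem_univ _, by simp⟩
    rw [hsplit] at this h0
    linarith
  set β := -l (0, 1) with hβ
  have hβpos : 0 < β := by linarith
  let l' : StrongDual ℝ E := l.comp (ContinuousLinearMap.inl ℝ E ℝ)
  set u : E := β⁻¹ • (InnerProductSpace.toDual ℝ E).symm l' with hu
  have hinner : ∀ y, β * ⟪u, y⟫ = l (y, 0) := by
    intro y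
    rw [hu, real_inner_smul_left, InnerProductSpace.toDual_symm_apply, ← mul_assoc,
      mul_inv_cancel₀ hβpos.ne', one_mul]
    simp [l']
  have hge : ∀ y, l (y, 0) - β * f y ≤ c := by
    intro y
    have : ∀ ε > 0, l (y, 0) - β * f y ≤ c + ε := by
      intro ε hε
      have h1 := hl1 (y, f y + ε / β) ⟨Set.mem_univ _, by simp [div_pos hε hβpos]⟩
      rw [hsplit] at h1
      have h2 : (f y + ε / β) * l (0, 1) = - β * f y - ε := by
        rw [show l (0, 1) = -β by rw [hβ]; ring]; field_simp; ring
      linarith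
    exact le_of_forall_pos_le_add this
  have hc : c = l (x, 0) - β * f x := by
    rw [hsplit] at h0
    refine le_antisymm ?_ (hge x)
    rw [hβ]; linarith
  refine ⟨u, fun y => ?_, fun y => ?_⟩
  · have h1 := hge y
    rw [hc, ← hinner, ← hinner] at h1
    rw [inner_sub_right]
    have : β * (f x + (⟪u, y⟫ - ⟪u, x⟫)) ≤ β * f y := by linarith
    exact le_of_mul_le_mul_left this hβpos
  · have h1 := hl2 (y, f x + h x - h y) ⟨Set.mem_univ _, le_rfl⟩
    rw [hsplit, hc, ← hinner, ← hinner, show l (0, 1) = -β by rw [hβ]; ring] at h1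
    rw [inner_sub_right]
    have : β * (h x - (⟪u, y⟫ - ⟪u, x⟫)) ≤ β * h y := by linarith
    exact le_of_mul_le_mul_left this hβpos

/-- A saddle point `(x, x, u)` of the Lagrangian of the problem of minimizing
`φ w + ‖w‖² / 2 + h z` subject to `w = z`. -/
structure IsSaddle (φ h : E → ℝ) (x u : E) : Prop where
  left : ∀ y, φ x + 1 / 2 * ‖x‖ ^ 2 + ⟪u, y - x⟫ + 1 / 2 * ‖y - x‖ ^ 2 ≤ φ y + 1 / 2 * ‖y‖ ^ 2
  right : ∀ y, h x - ⟪u, y - x⟫ ≤ h y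

/-- The hypothesis makes u - x a subgradient of the convex φ at x; the exact expansion of ‖y‖² / 2
around x then restores the quadratic term. -/
theorem strong_subgradient {φ : E → ℝ} (hφ : ConvexOn ℝ Set.univ φ) {x u : E}
    (hx : ∀ y, φ x + 1 / 2 * ‖x‖ ^ 2 + ⟪u, y - x⟫ ≤ φ y + 1 / 2 * ‖y‖ ^ 2) (y : E) :
    φ x + 1 / 2 * ‖x‖ ^ 2 + ⟪u, y - x⟫ + 1 / 2 * ‖y - x‖ ^ 2 ≤ φ y + 1 / 2 * ‖y‖ ^ 2 := by
  have := subgradient_of_isMin hφ (x := x) (g := x - u) (c := 1 / 2) (fun z => by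
    have h1 := hx z
    rw [half_sq_norm_add x z] at h1
    rw [inner_sub_left]
    linarith) y
  rw [inner_sub_left] at this
  rw [half_sq_norm_add x y]
  linarith

theorem exists_isSaddle [FiniteDimensional ℝ E] {φ h : E → ℝ} (hφ : ConvexOn ℝ Set.univ φ)
    (hh : ConvexOn ℝ Set.univ h) (hφ0 : ∀ x, 0 ≤ φ x) (hh0 : ∀ x, 0 ≤ h x) :
    ∃ x u, IsSaddle φ h x u := by
  have hφc : Continuous φ := hφ.locallyLipschitz.continuous
  have hhc : Continuous h := hh.locallyLipschitz.continuous
  have := FiniteDimensional.proper_real E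
  have : CompleteSpace E := FiniteDimensional.complete ℝ E
  set f : E → ℝ := fun x => φ x + 1 / 2 * ‖x‖ ^ 2 with hfdef
  have hfc : Continuous f := by fun_prop
  have hsq : ConvexOn ℝ Set.univ (fun x : E => 1 / 2 * ‖x‖ ^ 2) :=
    ((convexOn_norm convex_univ).pow (fun _ _ => norm_nonneg _) 2).smul (by norm_num)
  have hf : ConvexOn ℝ Set.univ f := hφ.add hsq
  obtain ⟨x, hx⟩ := (show Continuous fun x => f x + h x by fun_prop).exists_forall_le (by
    have h1 : Tendsto (fun x : E => 1 / 2 * ‖x‖ ^ 2) (cocompact E) atTop :=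
      ((tendsto_pow_atTop two_ne_zero).comp (tendsto_norm_cocompact_atTop (E := E))).const_mul_atTop
        (by norm_num)
    refine tendsto_atTop_mono (fun x => ?_) h1
    have := hφ0 x
    have := hh0 x
    simp only [hfdef]
    linarith)
  obtain ⟨u, hu1, hu2⟩ := exists_multiplier_of_isMin hf hfc hh hx
  exact ⟨x, u, strong_subgradient hφ hu1, hu2⟩

/-- The one-step decrease of the Lyapunov function of the method of multipliers. -/
theorem lyapunov_decrease {ρ τ : ℝ} (hρ : 0 < ρ) (hτ : 0 < τ) {v w z z₁ r₁ : E}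
    (h1 : ‖w‖ ^ 2 ≤ ⟪v, w⟫ - ρ * ⟪w - z₁, w⟫) (h2 : ⟪v, z⟫ - ρ * ⟪w - z, z⟫ ≤ 0)
    (h3 : (1 - τ) * ⟪r₁, z - z₁⟫ - ⟪w - z, z - z₁⟫ ≤ 0) :
    1 / (τ * ρ) * ‖v - (τ * ρ) • (w - z)‖ ^ 2 + ρ * ‖z‖ ^ 2 + ρ * (1 - τ) ^ 2 * ‖w - z‖ ^ 2
        + 2 * ‖w‖ ^ 2 + ρ * (1 + τ - τ ^ 2) * ‖w - z‖ ^ 2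
      ≤ 1 / (τ * ρ) * ‖v‖ ^ 2 + ρ * ‖z₁‖ ^ 2 + ρ * (1 - τ) ^ 2 * ‖r₁‖ ^ 2 := by
  have h4 : 1 / (τ * ρ) * ‖v - (τ * ρ) • (w - z)‖ ^ 2
      = 1 / (τ * ρ) * ‖v‖ ^ 2 - 2 * ⟪v, w - z⟫ + τ * ρ * ‖w - z‖ ^ 2 := by
    rw [norm_sub_sq_real, inner_smul_right, norm_smul, mul_pow, Real.norm_eq_abs, sq_abs]
    field_simp
  -- This square absorbs the cross term of `h3`. The coefficients τρ, ρ(1 - τ)² and ρ(1 + τ - τ²) of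
  -- ‖w - z‖² add up to 2ρ, exactly what `h1` and `h2` supply.
  have h5 := sq_nonneg ‖(1 - τ) • r₁ + (z - z₁)‖
  rw [norm_add_sq_real, norm_smul, mul_pow, Real.norm_eq_abs, sq_abs, real_inner_smul_left] at h5
  rw [h4]
  have h6 := norm_sub_sq_real w z
  have h7 := norm_sub_sq_real z z₁
  simp only [inner_sub_left, inner_sub_right, real_inner_self_eq_norm_sq] at *
  rw [real_inner_comm w z₁] at h1
  linear_combination 2 * h1 + 2 * h2 + 2 * ρ * h3 + ρ * h5 + 2 * ρ * h6 + ρ * h7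

/-- The alternating direction method of multipliers with dual step size `τ` converges for
`1 + τ - τ² > 0`, that is, for `τ` below the golden ratio. -/
theorem admm_tendsto [FiniteDimensional ℝ E] {φ h : E → ℝ} (hφ : ConvexOn ℝ Set.univ φ)
    (hh : ConvexOn ℝ Set.univ h) (hφ0 : ∀ x, 0 ≤ φ x) (hh0 : ∀ x, 0 ≤ h x)
    {ρ τ : ℝ} (hρ : 0 < ρ) (hτ : 0 < τ) (hτ' : 0 < 1 + τ - τ ^ 2) {W Z U : ℕ → E}
    (hW : ∀ k w, φ (W (k + 1)) + 1 / 2 * ‖W (k + 1)‖ ^ 2 - ⟪U k, W (k + 1) - Z k⟫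
        + ρ / 2 * ‖W (k + 1) - Z k‖ ^ 2
      ≤ φ w + 1 / 2 * ‖w‖ ^ 2 - ⟪U k, w - Z k⟫ + ρ / 2 * ‖w - Z k‖ ^ 2)
    (hZ : ∀ k z, h (Z (k + 1)) + ρ / 2 * ‖Z (k + 1) - (W (k + 1) - (1 / ρ) • U k)‖ ^ 2
      ≤ h z + ρ / 2 * ‖z - (W (k + 1) - (1 / ρ) • U k)‖ ^ 2)
    (hU : ∀ k, U (k + 1) = U k - (τ * ρ) • (W (k + 1) - Z (k + 1))) :
    ∃ x u, IsSaddle φ h x u ∧ Tendsto W atTop (𝓝 x) ∧ Tendsto Z atTop (𝓝 x) ∧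
      Tendsto U atTop (𝓝 u) := by
  have hφc : Continuous φ := hφ.locallyLipschitz.continuous
  have hhc : Continuous h := hh.locallyLipschitz.continuous
  have := FiniteDimensional.proper_real E
  -- optimality conditions of the two subproblems
  have hW' : ∀ k y, φ (W (k + 1)) + 1 / 2 * ‖W (k + 1)‖ ^ 2
      + ⟪U k - ρ • (W (k + 1) - Z k), y - W (k + 1)⟫ + 1 / 2 * ‖y - W (k + 1)‖ ^ 2
      ≤ φ y + 1 / 2 * ‖y‖ ^ 2 := by
    intro k
    apply strong_subgradient hφ
    intro y
    have := subgradient_of_isMin hφ (x := W (k + 1))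
      (g := W (k + 1) - (U k - ρ • (W (k + 1) - Z k))) (c := 1 / 2 + ρ / 2) (fun z => by
        have h1 := hW k z
        rw [half_sq_norm_add (W (k + 1)) z] at h1
        have h2 := half_sq_norm_add (W (k + 1) - Z k) (z - Z k)
        have h3 : z - Z k - (W (k + 1) - Z k) = z - W (k + 1) := by abel
        rw [h3] at h2
        have h4 : ⟪U k, z - Z k⟫ = ⟪U k, W (k + 1) - Z k⟫ + ⟪U k, z - W (k + 1)⟫ := by
          rw [← inner_add_right]; congr 1; abel
        rw [inner_sub_left, inner_sub_left, real_inner_smul_left]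
        linear_combination h1 + ρ * h2 - h4) y
    rw [inner_sub_left] at this
    rw [half_sq_norm_add (W (k + 1)) y]
    nlinarith [sq_nonneg ‖y - W (k + 1)‖]
  have hZ' : ∀ k y, h (Z (k + 1)) - ⟪U k - ρ • (W (k + 1) - Z (k + 1)), y - Z (k + 1)⟫ ≤ h y := by
    intro k y
    have := subgradient_of_isMin hh (x := Z (k + 1))
      (g := U k - ρ • (W (k + 1) - Z (k + 1))) (c := ρ / 2) (fun z => by
        have h1 := hZ k z
        have h2 := half_sq_norm_add (Z (k + 1) - (W (k + 1) - (1 / ρ) • U k))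
          (z - (W (k + 1) - (1 / ρ) • U k))
        have h3 : z - (W (k + 1) - (1 / ρ) • U k) - (Z (k + 1) - (W (k + 1) - (1 / ρ) • U k))
          = z - Z (k + 1) := by abel
        have h4 : ρ * ⟪Z (k + 1) - (W (k + 1) - (1 / ρ) • U k), z - Z (k + 1)⟫
            = ⟪U k - ρ • (W (k + 1) - Z (k + 1)), z - Z (k + 1)⟫ := by
          rw [← real_inner_smul_left]
          congr 1
          rw [smul_sub, smul_sub, smul_smul, smul_sub]
          rw [mul_one_div_cancel hρ.ne', one_smul]
          abel
        rw [h3] at h2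
        linear_combination h1 + ρ * h2 + h4) y
    linarith
  -- the Lyapunov function
  set r : ℕ → E := fun k => W k - Z k with hr
  set c : ℝ := ρ * (1 + τ - τ ^ 2) with hc
  have hcpos : 0 < c := mul_pos hρ hτ'
  let A : E → E → ℕ → ℝ := fun x u k =>
    1 / (τ * ρ) * ‖U k - u‖ ^ 2 + ρ * ‖Z k - x‖ ^ 2 + ρ * (1 - τ) ^ 2 * ‖r k‖ ^ 2
  have hA0 : ∀ x u k, 0 ≤ A x u k := fun x u k => by positivity
  -- The decrease starts at index 1: it compares two consecutive Z-steps (`i5`, `i6`), and `Z 0`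
  -- does not come from such a step.
  have hdec : ∀ x u, IsSaddle φ h x u → ∀ k,
      A x u (k + 2) + 2 * ‖W (k + 2) - x‖ ^ 2 + c * ‖r (k + 2)‖ ^ 2 ≤ A x u (k + 1) := by
    intro x u hs k
    have e1 : U (k + 2) - u = (U (k + 1) - u) - (τ * ρ) • ((W (k + 2) - x) - (Z (k + 2) - x)) := by
      rw [hU (k + 1), sub_sub_sub_cancel_right]; abel
    have e2 : r (k + 2) = (W (k + 2) - x) - (Z (k + 2) - x) := by simp [hr]
    have e3 : U k = U (k + 1) + (τ * ρ) • r (k + 1) := by rw [hU k]; simp [hr]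
    have i1 := hs.left (W (k + 2))
    have i2 := hW' (k + 1) x
    have i3 := hs.right (Z (k + 2))
    have i4 := hZ' (k + 1) x
    have i5 := hZ' (k + 1) (Z (k + 1))
    have i6 := hZ' k (Z (k + 2))
    simp only [A, e1, e2]
    rw [hc]
    apply lyapunov_decrease hρ hτ
    · have h1 : ‖x - W (k + 2)‖ = ‖W (k + 2) - x‖ := norm_sub_rev _ _
      rw [h1, ← neg_sub (W (k + 2)) x, inner_neg_right, inner_sub_left (U (k + 1)),
        real_inner_smul_left] at i2
      rw [inner_sub_left, sub_sub_sub_cancel_right]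
      linarith
    · rw [← neg_sub (Z (k + 2)) x, inner_neg_right, inner_sub_left (U (k + 1)),
        real_inner_smul_left] at i4
      rw [inner_sub_left, sub_sub_sub_cancel_right]
      linarith
    · rw [← neg_sub (Z (k + 2)) (Z (k + 1)), inner_neg_right, inner_sub_left (U (k + 1)),
        real_inner_smul_left] at i5
      rw [e3, inner_sub_left, inner_add_left, real_inner_smul_left, real_inner_smul_left] at i6
      rw [sub_sub_sub_cancel_right, sub_sub_sub_cancel_right]
      have : ρ * ((1 - τ) * ⟪r (k + 1), Z (k + 2) - Z (k + 1)⟫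
          - ⟪W (k + 2) - Z (k + 2), Z (k + 2) - Z (k + 1)⟫) ≤ 0 := by
        simp only [hr] at i6 ⊢
        linarith
      exact nonpos_of_mul_nonpos_right this hρ
  have hanti : ∀ x u, IsSaddle φ h x u → Antitone fun k => A x u (k + 1) := by
    intro x u hs
    refine antitone_nat_of_succ_le fun k => ?_
    have := hdec x u hs k
    nlinarith [sq_nonneg ‖W (k + 2) - x‖, sq_nonneg ‖r (k + 2)‖]
  have hAlim : ∀ x u, IsSaddle φ h x u → ∃ l, Tendsto (fun k => A x u (k + 1)) atTop (𝓝 l) :=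
    fun x u hs => ⟨_, tendsto_atTop_ciInf (hanti x u hs) ⟨0, by rintro _ ⟨k, rfl⟩; exact hA0 _ _ _⟩⟩
  obtain ⟨x, u₀, hs₀⟩ := exists_isSaddle hφ hh hφ0 hh0
  have hzero : ∀ {v : ℕ → E} {a : ℝ}, 0 < a → ∀ {b : ℕ → ℝ}, Tendsto b atTop (𝓝 0) →
      (∀ k, a * ‖v k‖ ^ 2 ≤ b k) → Tendsto v atTop (𝓝 0) := by
    intro v a ha b hb hv
    rw [tendsto_zero_iff_norm_tendsto_zero]
    have h1 : Tendsto (fun k => ‖v k‖ ^ 2) atTop (𝓝 0) := by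
      refine squeeze_zero (fun _ => sq_nonneg _) (fun k => ?_) (by simpa using hb.const_mul a⁻¹)
      rw [inv_mul_eq_div, le_div_iff₀ ha, mul_comm]
      exact hv k
    simpa using h1.sqrt
  obtain ⟨hWx, hrx⟩ : Tendsto W atTop (𝓝 x) ∧ Tendsto r atTop (𝓝 0) := by
    obtain ⟨l, hl⟩ := hAlim x u₀ hs₀
    have hdiff : Tendsto (fun k => A x u₀ (k + 1) - A x u₀ (k + 2)) atTop (𝓝 0) := by
      simpa using hl.sub (hl.comp (tendsto_add_atTop_nat 1))
    constructor
    · rw [← tendsto_add_atTop_iff_nat 2, ← tendsto_sub_nhds_zero_iff]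
      refine hzero two_pos hdiff fun k => ?_
      nlinarith [hdec x u₀ hs₀ k, sq_nonneg ‖r (k + 2)‖]
    · rw [← tendsto_add_atTop_iff_nat 2]
      refine hzero hcpos hdiff fun k => ?_
      nlinarith [hdec x u₀ hs₀ k, sq_nonneg ‖W (k + 2) - x‖]
  have hZx : Tendsto Z atTop (𝓝 x) := by
    have := hWx.sub hrx
    simpa [hr] using this
  -- a cluster point of the multipliers is an optimal multiplier
  have hbd : ∀ k, U (k + 1) ∈ Metric.closedBall u₀ (Real.sqrt (τ * ρ * A x u₀ 1)) := by
    intro k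
    rw [mem_closedBall_iff_norm]
    apply Real.le_sqrt_of_sq_le
    have h1 : A x u₀ (k + 1) ≤ A x u₀ 1 := hanti x u₀ hs₀ (Nat.zero_le k)
    have h2 : 1 / (τ * ρ) * ‖U (k + 1) - u₀‖ ^ 2 ≤ A x u₀ (k + 1) := by
      simp only [A]
      have : 0 ≤ ρ * ‖Z (k + 1) - x‖ ^ 2 + ρ * (1 - τ) ^ 2 * ‖r (k + 1)‖ ^ 2 := by positivity
      linarith
    have h3 := h2.trans h1
    rw [one_div, inv_mul_le_iff₀ (by positivity)] at h3
    exact h3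
  obtain ⟨u, -, ψ, hψ, hu⟩ := (isCompact_closedBall u₀ _).tendsto_subseq hbd
  have hψ' : Tendsto (fun k => ψ k + 1) atTop atTop :=
    (tendsto_add_atTop_nat 1).comp hψ.tendsto_atTop
  have hψ'' : Tendsto (fun k => ψ k + 1 + 1) atTop atTop := (tendsto_add_atTop_nat 1).comp hψ'
  replace hu : Tendsto (fun k => U (ψ k + 1)) atTop (𝓝 u) := hu
  have hs : IsSaddle φ h x u := by
    constructor
    · intro y
      have hw := hWx.comp hψ''
      have hz := hZx.comp hψ'
      have hlim : Tendsto (fun k => φ (W (ψ k + 1 + 1)) + 1 / 2 * ‖W (ψ k + 1 + 1)‖ ^ 2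
          + ⟪U (ψ k + 1) - ρ • (W (ψ k + 1 + 1) - Z (ψ k + 1)), y - W (ψ k + 1 + 1)⟫
          + 1 / 2 * ‖y - W (ψ k + 1 + 1)‖ ^ 2) atTop
          (𝓝 (φ x + 1 / 2 * ‖x‖ ^ 2 + ⟪u - ρ • (x - x), y - x⟫ + 1 / 2 * ‖y - x‖ ^ 2)) :=
        ((((hφc.tendsto x).comp hw).add ((hw.norm.pow 2).const_mul _)).add
          ((hu.sub ((hw.sub hz).const_smul ρ)).inner (hw.const_sub y))).add
          (((hw.const_sub y).norm.pow 2).const_mul _)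
      rw [sub_self, smul_zero, sub_zero] at hlim
      exact le_of_tendsto' hlim fun k => hW' (ψ k + 1) y
    · intro y
      have hw := hWx.comp hψ''
      have hz := hZx.comp hψ''
      have hlim : Tendsto (fun k => h (Z (ψ k + 1 + 1))
          - ⟪U (ψ k + 1) - ρ • (W (ψ k + 1 + 1) - Z (ψ k + 1 + 1)), y - Z (ψ k + 1 + 1)⟫) atTop
          (𝓝 (h x - ⟪u - ρ • (x - x), y - x⟫)) :=
        ((hhc.tendsto x).comp hz).sub
          ((hu.sub ((hw.sub hz).const_smul ρ)).inner (hz.const_sub y))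
      rw [sub_self, smul_zero, sub_zero] at hlim
      exact le_of_tendsto' hlim fun k => hZ' (ψ k + 1) y
  refine ⟨x, u, hs, hWx, hZx, ?_⟩
  -- The Lyapunov function is now taken at the cluster point u. It converges, and along the
  -- subsequence its limit is 0, so the whole sequence U converges to u.
  obtain ⟨l, hl⟩ := hAlim x u hs
  have hl0 : l = 0 := by
    refine tendsto_nhds_unique (hl.comp hψ.tendsto_atTop) ?_
    have : Tendsto (fun k => A x u (ψ k + 1)) atTop
        (𝓝 (1 / (τ * ρ) * ‖u - u‖ ^ 2 + ρ * ‖x - x‖ ^ 2 + ρ * (1 - τ) ^ 2 * ‖(0 : E)‖ ^ 2)) :=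
      ((((hu.sub_const u).norm.pow 2).const_mul _).add
        ((((hZx.comp hψ').sub_const x).norm.pow 2).const_mul _)).add
        (((hrx.comp hψ').norm.pow 2).const_mul _)
    simpa [Function.comp_def] using this
  rw [hl0] at hl
  rw [← tendsto_add_atTop_iff_nat 1, ← tendsto_sub_nhds_zero_iff]
  refine hzero (a := 1 / (τ * ρ)) (by positivity) hl fun k => ?_
  simp only [A]
  have : 0 ≤ ρ * ‖Z (k + 1) - x‖ ^ 2 + ρ * (1 - τ) ^ 2 * ‖r (k + 1)‖ ^ 2 := by positivity
  linarith

end Convex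

/-! ### The hinge loss as a function of the bias. -/

section Hinge

variable {N : ℕ}

/-- The hinge loss as a function of the bias `b`, where `w i` is the value of the linear part of
the decision function at the `i`-th sample. -/
noncomputable def hingeSum (y w : Fin N → ℝ) (b : ℝ) : ℝ :=
  ∑ i, max 0 (1 - y i * (w i + b))

/-- The set of optimal biases. -/
def hingeArgmin (y w : Fin N → ℝ) : Set ℝ := {b | ∀ b', hingeSum y w b ≤ hingeSum y w b'}

theorem hingeSum_nonneg (y w : Fin N → ℝ) (b : ℝ) : 0 ≤ hingeSum y w b :=
  Finset.sum_nonneg fun _ _ => le_max_left _ _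

theorem continuous_hingeSum (y w : Fin N → ℝ) : Continuous (hingeSum y w) := by
  unfold hingeSum; fun_prop

theorem hingeSum_neg (y w : Fin N → ℝ) (b : ℝ) :
    hingeSum (-y) (-w) (-b) = hingeSum y w b := by
  refine Finset.sum_congr rfl fun i _ => ?_
  simp only [Pi.neg_apply]
  ring_nf

/-- Clamping `b` to [-R, R] increases no summand: past either end, a summand is already zero at that
end or keeps growing outwards. So the search is over a compact interval. -/
theorem hingeArgmin_nonempty {y : Fin N → ℝ} (hy : ∀ i, y i = 1 ∨ y i = -1) (w : Fin N → ℝ) :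
    (hingeArgmin y w).Nonempty := by
  set R : ℝ := ∑ i, (1 + |w i|) with hR
  have hR0 : 0 ≤ R := Finset.sum_nonneg fun i _ => by positivity
  have hRi : ∀ i, 1 + |w i| ≤ R := fun i =>
    Finset.single_le_sum (f := fun i => 1 + |w i|) (fun i _ => by positivity) (Finset.mem_univ i)
  obtain ⟨b₀, -, hb₀⟩ := isCompact_Icc.exists_isMinOn (Set.nonempty_Icc.2 (by linarith : -R ≤ R))
    (continuous_hingeSum y w).continuousOn
  refine ⟨b₀, fun b => ?_⟩
  have hclamp : hingeSum y w (max (-R) (min R b)) ≤ hingeSum y w b := by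
    refine Finset.sum_le_sum fun i _ => max_le (le_max_left _ _) ?_
    have h1 := hRi i
    have h2 := neg_abs_le (w i)
    have h3 := le_abs_self (w i)
    rcases le_total b (-R) with h | h
    · rw [min_eq_right (by linarith), max_eq_left h]
      rcases hy i with hi | hi <;> rw [hi]
      · exact le_max_of_le_right (by linarith)
      · exact le_max_of_le_left (by linarith)
    · rcases le_total b R with h' | h'
      · rw [min_eq_right h', max_eq_right h]
        exact le_max_right _ _
      · rw [min_eq_left h', max_eq_right (by linarith)]
        rcases hy i with hi | hi <;> rw [hi]
        · exact le_max_of_le_left (by linarith)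
        · exact le_max_of_le_right (by linarith)
  refine le_trans (hb₀ ⟨le_max_left _ _, max_le (by linarith) (min_le_left _ _)⟩) hclamp

theorem isClosed_hingeArgmin (y w : Fin N → ℝ) : IsClosed (hingeArgmin y w) := by
  have : hingeArgmin y w = ⋂ b', {b | hingeSum y w b ≤ hingeSum y w b'} := by
    ext; simp [hingeArgmin]
  rw [this]
  exact isClosed_iInter fun b' => isClosed_le (continuous_hingeSum y w) continuous_const

theorem abs_hingeSum_sub_le {y : Fin N → ℝ} (hy : ∀ i, y i = 1 ∨ y i = -1) (w w' : Fin N → ℝ)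
    (b : ℝ) : |hingeSum y w b - hingeSum y w' b| ≤ ∑ i, |w i - w' i| := by
  rw [hingeSum, hingeSum, ← Finset.sum_sub_distrib]
  refine (Finset.abs_sum_le_sum_abs _ _).trans (Finset.sum_le_sum fun i _ => ?_)
  rw [max_comm, max_comm 0]
  refine (abs_max_sub_max_le_abs _ _ _).trans ?_
  have : 1 - y i * (w i + b) - (1 - y i * (w' i + b)) = - (y i * (w i - w' i)) := by ring
  rw [this, abs_neg, abs_mul]
  rcases hy i with hi | hi <;> simp [hi]

/-- The right slope p is recorded as an integer, so that a positive total slope is at least 1; this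
is what makes the minima sharp with constant 1. -/
theorem hinge_right_affine {y w β : ℝ} (hy : y = 1 ∨ y = -1) :
    ∃ p : ℤ, (∀ b, β ≤ b → max 0 (1 - y * (w + β)) + p * (b - β) ≤ max 0 (1 - y * (w + b))) ∧
      ∀ᶠ b in 𝓝[>] β, max 0 (1 - y * (w + b)) = max 0 (1 - y * (w + β)) + p * (b - β) := by
  rcases hy with rfl | rfl
  · rcases le_or_gt (1 - (w + β)) 0 with h | h
    · refine ⟨0, fun b hb => ?_, ?_⟩
      · simp [h]
      · filter_upwards [self_mem_nhdsWithin] with b hb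
        have hb : β < b := hb
        rw [max_eq_left (by linarith), max_eq_left (by linarith)]
        simp
    · refine ⟨-1, fun b hb => ?_, ?_⟩
      · rw [max_eq_right (by linarith)]
        exact le_max_of_le_right (by push_cast; linarith)
      · filter_upwards [Ioo_mem_nhdsGT (show β < 1 - w by linarith)] with b hb
        rw [max_eq_right (by linarith [hb.2]), max_eq_right (by linarith)]
        push_cast; ring
  · rcases lt_or_ge (1 + (w + β)) 0 with h | h
    · refine ⟨0, fun b hb => ?_, ?_⟩
      · rw [max_eq_left (by linarith)]
        simp
      · filter_upwards [Ioo_mem_nhdsGT (show β < -1 - w by linarith)] with b hb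
        rw [max_eq_left (by linarith [hb.2]), max_eq_left (by linarith)]
        simp
    · refine ⟨1, fun b hb => ?_, ?_⟩
      · rw [max_eq_right (by linarith), max_eq_right (by linarith)]
        push_cast; linarith
      · filter_upwards [self_mem_nhdsWithin] with b hb
        have hb : β < b := hb
        rw [max_eq_right (by linarith), max_eq_right (by linarith)]
        push_cast; ring

theorem hingeSum_sharp_right {y : Fin N → ℝ} (hy : ∀ i, y i = 1 ∨ y i = -1) {w : Fin N → ℝ}
    {β b : ℝ} (hβ : β ∈ hingeArgmin y w) (hb : β < b)
    (hout : ∀ c ∈ Set.Ioo β b, c ∉ hingeArgmin y w) :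
    hingeSum y w β + (b - β) ≤ hingeSum y w b := by
  choose p hp hp' using fun i => hinge_right_affine (w := w i) (β := β) (hy i)
  have hle : hingeSum y w β + ((∑ i, p i : ℤ) : ℝ) * (b - β) ≤ hingeSum y w b := by
    push_cast
    rw [hingeSum, Finset.sum_mul, ← Finset.sum_add_distrib]
    exact Finset.sum_le_sum fun i _ => hp i b hb.le
  obtain ⟨c, hc, hcb⟩ := ((eventually_all.2 hp').and (Ioo_mem_nhdsGT hb)).exists
  have heq : hingeSum y w c = hingeSum y w β + ((∑ i, p i : ℤ) : ℝ) * (c - β) := by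
    push_cast
    rw [hingeSum, hingeSum, Finset.sum_mul, ← Finset.sum_add_distrib]
    exact Finset.sum_congr rfl fun i _ => hc i
  -- With total right slope at most 0, the nearby point `c` would also be a minimizer, against
  -- `hout`.
  have hpos : 1 ≤ ∑ i, p i := by
    by_contra! hneg
    have h0 : ((∑ i, p i : ℤ) : ℝ) ≤ 0 := by exact_mod_cast (by omega : ∑ i, p i ≤ 0)
    refine hout c hcb fun b' => ?_
    have := hβ b'
    nlinarith [hcb.1]
  have h1 : (1 : ℝ) ≤ ((∑ i, p i : ℤ) : ℝ) := by exact_mod_cast hpos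
  nlinarith

theorem mem_hingeArgmin_neg {y w : Fin N → ℝ} {b : ℝ} :
    -b ∈ hingeArgmin (-y) (-w) ↔ b ∈ hingeArgmin y w := by
  constructor
  · intro h b'
    have := h (-b')
    rwa [hingeSum_neg, hingeSum_neg] at this
  · intro h b'
    have := h (-b')
    rw [← hingeSum_neg, ← hingeSum_neg y w (-b'), neg_neg] at this
    exact this

/-- Optimal biases are sharp minima of the hinge loss. -/
theorem hingeSum_add_infDist_le {y : Fin N → ℝ} (hy : ∀ i, y i = 1 ∨ y i = -1) {w : Fin N → ℝ}
    {b₀ : ℝ} (hb₀ : b₀ ∈ hingeArgmin y w) (b : ℝ) :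
    hingeSum y w b₀ + Metric.infDist b (hingeArgmin y w) ≤ hingeSum y w b := by
  obtain ⟨β, hβ, hd⟩ := (isClosed_hingeArgmin y w).exists_infDist_eq_dist ⟨b₀, hb₀⟩ b
  have h0 : hingeSum y w b₀ = hingeSum y w β := le_antisymm (hb₀ β) (hβ b₀)
  have hout : ∀ c, |b - c| < |b - β| → c ∉ hingeArgmin y w := by
    intro c hc hmem
    have := Metric.infDist_le_dist_of_mem (x := b) hmem
    rw [hd, Real.dist_eq, Real.dist_eq] at this
    linarith
  rw [hd, h0, Real.dist_eq]
  rcases lt_trichotomy β b with h | h | h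
  · rw [abs_of_pos (sub_pos.2 h)] at hout ⊢
    exact hingeSum_sharp_right hy hβ h fun c hc => hout c (by
      rw [abs_of_pos (sub_pos.2 hc.2)]; linarith [hc.1])
  · simp [h]
  -- The left side follows from the right one by the reflection (y, w, b) ↦ (-y, -w, -b).
  · rw [abs_of_neg (sub_neg.2 h)] at hout ⊢
    rw [← hingeSum_neg y w b, ← hingeSum_neg y w β]
    have := hingeSum_sharp_right (y := -y) (w := -w) (β := -β) (b := -b)
      (fun i => by rcases hy i with hi | hi <;> simp [hi]) (mem_hingeArgmin_neg.2 hβ)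
      (neg_lt_neg h) (fun c hc hmem => by
        rw [← neg_neg c, mem_hingeArgmin_neg] at hmem
        refine hout (-c) ?_ hmem
        rw [abs_lt]
        constructor <;> linarith [hc.1, hc.2])
    linarith

/-- By sharpness the distance is at most the excess loss of `b k` at `w₀`. Since `b k` is optimal
for `w k`, passing between `w₀` and `w k` twice bounds this excess by 2 ∑ |w k i - w₀ i|. -/
theorem tendsto_infDist_hingeArgmin {y : Fin N → ℝ} (hy : ∀ i, y i = 1 ∨ y i = -1)
    {w : ℕ → Fin N → ℝ} {w₀ : Fin N → ℝ} (hw : Tendsto w atTop (𝓝 w₀)) {b : ℕ → ℝ}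
    (hb : ∀ᶠ k in atTop, b k ∈ hingeArgmin y (w k)) :
    Tendsto (fun k => Metric.infDist (b k) (hingeArgmin y w₀)) atTop (𝓝 0) := by
  obtain ⟨b₀, hb₀⟩ := hingeArgmin_nonempty hy w₀
  have hlim : Tendsto (fun k => 2 * ∑ i, |w k i - w₀ i|) atTop (𝓝 0) := by
    have : Tendsto (fun k => 2 * ∑ i, |w k i - w₀ i|) atTop (𝓝 (2 * ∑ i, |w₀ i - w₀ i|)) :=
      (tendsto_finsetSum _ fun i _ => ((tendsto_pi_nhds.1 hw i).sub_const _).abs).const_mul 2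
    simpa using this
  refine squeeze_zero' (Eventually.of_forall fun _ => Metric.infDist_nonneg) ?_ hlim
  filter_upwards [hb] with k hk
  have h1 := hingeSum_add_infDist_le hy hb₀ (b k)
  have h2 := abs_le.1 (abs_hingeSum_sub_le hy (w k) w₀ (b k))
  have h3 := abs_le.1 (abs_hingeSum_sub_le hy (w k) w₀ b₀)
  have h4 := hk b₀
  linarith [h2.1, h3.2]

/-- A dual certificate for the optimality of the bias `b`: the multipliers `α` are balanced and
complementary to the margins. -/
structure IsBiasCertificate (C : ℝ) (y w : Fin N → ℝ) (b : ℝ) (α : Fin N → ℝ) : Prop where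
  balanced : ∑ i, α i * y i = 0
  nonneg : ∀ i, 0 ≤ α i
  le : ∀ i, α i ≤ C
  active : ∀ i, 0 < α i → 0 ≤ 1 - y i * (w i + b)
  inactive : ∀ i, α i < C → 1 - y i * (w i + b) ≤ 0

theorem IsBiasCertificate.mul_max {C b : ℝ} {y w α : Fin N → ℝ}
    (h : IsBiasCertificate C y w b α) (i : Fin N) :
    C * max 0 (1 - y i * (w i + b)) = α i * (1 - y i * (w i + b)) := by
  rcases (h.nonneg i).eq_or_lt with h0 | h0
  · rcases (h.le i).eq_or_lt with h1 | h1
    · rw [← h0, ← h1, ← h0]; simp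
    · rw [max_eq_left (h.inactive i h1), ← h0]; simp
  · rw [max_eq_right (h.active i h0)]
    rcases (h.le i).eq_or_lt with h1 | h1
    · rw [h1]
    · rw [le_antisymm (h.inactive i h1) (h.active i h0)]; simp

/-- If the limit problem has two optimal biases, then no certificate of a nearby problem has a
multiplier strictly between the bounds. -/
theorem not_two_argmin_of_certificate {C : ℝ} (hC : 0 < C) {y : Fin N → ℝ}
    (hy : ∀ i, y i = 1 ∨ y i = -1) {w₀ w : Fin N → ℝ} {b₁ b₂ : ℝ} (hlt : b₁ < b₂)
    (hb₁ : b₁ ∈ hingeArgmin y w₀) (hb₂ : b₂ ∈ hingeArgmin y w₀)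
    (hw : ∀ i, |w i - w₀ i| < (b₂ - b₁) / 2) {b : ℝ} {α : Fin N → ℝ}
    (hα : IsBiasCertificate C y w b α) (j : Fin N) (hj0 : 0 < α j) (hjC : α j < C) : False := by
  set c := (b₁ + b₂) / 2 with hc
  have hsum : hingeSum y w₀ b₁ + hingeSum y w₀ b₂ ≤ 2 * hingeSum y w₀ c := by
    linarith [hb₁ c, hb₂ c]
  have hconv : ∀ i, 2 * max 0 (1 - y i * (w₀ i + c))
      ≤ max 0 (1 - y i * (w₀ i + b₁)) + max 0 (1 - y i * (w₀ i + b₂)) := by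
    intro i
    have h1 := le_max_left 0 (1 - y i * (w₀ i + b₁))
    have h2 := le_max_right 0 (1 - y i * (w₀ i + b₁))
    have h3 := le_max_left 0 (1 - y i * (w₀ i + b₂))
    have h4 := le_max_right 0 (1 - y i * (w₀ i + b₂))
    rcases max_cases 0 (1 - y i * (w₀ i + c)) with ⟨h, -⟩ | ⟨h, -⟩ <;> rw [h]
    · linarith
    · rw [hc]; linarith
  have heq : ∀ i, 2 * max 0 (1 - y i * (w₀ i + c))
      = max 0 (1 - y i * (w₀ i + b₁)) + max 0 (1 - y i * (w₀ i + b₂)) := by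
    have : ∑ i, 2 * max 0 (1 - y i * (w₀ i + c))
        = ∑ i, (max 0 (1 - y i * (w₀ i + b₁)) + max 0 (1 - y i * (w₀ i + b₂))) := by
      refine le_antisymm (Finset.sum_le_sum fun i _ => hconv i) ?_
      rw [Finset.sum_add_distrib, ← Finset.mul_sum]
      exact hsum
    intro i
    exact (Finset.sum_eq_sum_iff_of_le fun i _ => hconv i).1 this i (Finset.mem_univ i)
  -- no breakpoint lies strictly between the two optimal biases
  have hdich : ∀ i, (0 ≤ 1 - y i * (w₀ i + b₁) ∧ 0 ≤ 1 - y i * (w₀ i + b₂)) ∨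
      (1 - y i * (w₀ i + b₁) ≤ 0 ∧ 1 - y i * (w₀ i + b₂) ≤ 0) := by
    intro i
    have h := heq i
    have hmid : 1 - y i * (w₀ i + c)
        = ((1 - y i * (w₀ i + b₁)) + (1 - y i * (w₀ i + b₂))) / 2 := by rw [hc]; ring
    rw [hmid] at h
    generalize 1 - y i * (w₀ i + b₁) = s at h ⊢
    generalize 1 - y i * (w₀ i + b₂) = t at h ⊢
    rcases le_total s 0 with hs | hs <;> rcases le_total t 0 with ht | ht
    · exact Or.inr ⟨hs, ht⟩
    · rw [max_eq_left hs, max_eq_right ht] at h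
      rcases max_cases 0 ((s + t) / 2) with ⟨h', -⟩ | ⟨h', -⟩ <;> rw [h'] at h
      · exact Or.inr ⟨hs, by linarith⟩
      · exact Or.inl ⟨by linarith, ht⟩
    · rw [max_eq_right hs, max_eq_left ht] at h
      rcases max_cases 0 ((s + t) / 2) with ⟨h', -⟩ | ⟨h', -⟩ <;> rw [h'] at h
      · exact Or.inr ⟨by linarith, ht⟩
      · exact Or.inl ⟨hs, by linarith⟩
    · exact Or.inl ⟨hs, ht⟩
  classical
  set A : Finset (Fin N) := Finset.univ.filter fun i =>
    0 ≤ 1 - y i * (w₀ i + b₁) ∧ 0 ≤ 1 - y i * (w₀ i + b₂) with hA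
  -- At both b₁ and b₂ the loss is the sum over `A` of the same affine functions; its two values
  -- agree, so the slope vanishes.
  have hbal : ∑ i ∈ A, y i = 0 := by
    have h1 : ∀ b', (b' = b₁ ∨ b' = b₂) →
        hingeSum y w₀ b' = ∑ i ∈ A, (1 - y i * (w₀ i + b')) := by
      intro b' hb'
      rw [hA, Finset.sum_filter, hingeSum]
      refine Finset.sum_congr rfl fun i _ => ?_
      split_ifs with hi
      · rcases hb' with rfl | rfl
        · exact max_eq_right hi.1
        · exact max_eq_right hi.2
      · have := (hdich i).resolve_left hi
        rcases hb' with rfl | rfl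
        · exact max_eq_left this.1
        · exact max_eq_left this.2
    have h2 : hingeSum y w₀ b₁ = hingeSum y w₀ b₂ := le_antisymm (hb₁ b₂) (hb₂ b₁)
    rw [h1 _ (Or.inl rfl), h1 _ (Or.inr rfl), ← sub_eq_zero, ← Finset.sum_sub_distrib] at h2
    have h3 : ∑ i ∈ A, y i * (b₂ - b₁) = 0 := by
      rw [← h2]; exact Finset.sum_congr rfl fun i _ => by ring
    rw [← Finset.sum_mul] at h3
    exact (mul_eq_zero.1 h3).resolve_right (sub_pos.2 hlt).ne'
  -- at the midpoint all margins of the nearby problem are strict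
  have hposA : ∀ i ∈ A, 0 < 1 - y i * (w i + c) := by
    intro i hi
    have hi := (Finset.mem_filter.1 hi).2
    have := abs_lt.1 (hw i)
    rcases hy i with h | h <;> rw [h] at hi ⊢ <;> rw [hc] <;> linarith [hi.1, hi.2, this.1, this.2]
  have hnegA : ∀ i ∉ A, 1 - y i * (w i + c) < 0 := by
    intro i hi
    have hi := (hdich i).resolve_left fun h => hi (Finset.mem_filter.2 ⟨Finset.mem_univ i, h⟩)
    have := abs_lt.1 (hw i)
    rcases hy i with h | h <;> rw [h] at hi ⊢ <;> rw [hc] <;> linarith [hi.1, hi.2, this.1, this.2]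
  have hmid : hingeSum y w c ≤ hingeSum y w b := by
    have h1 : hingeSum y w c = ∑ i ∈ A, (1 - y i * (w i + b)) := by
      have : ∑ i ∈ A, (1 - y i * (w i + b))
          = ∑ i ∈ A, (1 - y i * (w i + c)) + (∑ i ∈ A, y i) * (c - b) := by
        rw [Finset.sum_mul, ← Finset.sum_add_distrib]
        exact Finset.sum_congr rfl fun i _ => by ring
      rw [this, hbal, zero_mul, add_zero, hingeSum,
        ← Finset.sum_subset (Finset.subset_univ A) fun i _ hi => max_eq_left (hnegA i hi).le]
      exact Finset.sum_congr rfl fun i hi => max_eq_right (hposA i hi).le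
    rw [h1]
    exact (Finset.sum_le_sum fun i _ => le_max_right 0 _).trans
      (Finset.sum_le_sum_of_subset_of_nonneg (Finset.subset_univ A) fun i _ _ => le_max_left _ _)
  -- By balance the certificate value does not depend on the bias, so it can be evaluated at `c`.
  -- There index `j` loses strictly, because its margin is nonzero and its multiplier is neither 0
  -- nor C.
  have hstrict : C * hingeSum y w b < C * hingeSum y w c := by
    have h1 : C * hingeSum y w b = ∑ i, α i * (1 - y i * (w i + c)) := by
      have : ∑ i, α i * (1 - y i * (w i + c))
          = ∑ i, α i * (1 - y i * (w i + b)) + (∑ i, α i * y i) * (b - c) := by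
        rw [Finset.sum_mul, ← Finset.sum_add_distrib]
        exact Finset.sum_congr rfl fun i _ => by ring
      rw [this, hα.balanced, zero_mul, add_zero, hingeSum, Finset.mul_sum]
      exact Finset.sum_congr rfl fun i _ => hα.mul_max i
    rw [h1, hingeSum, Finset.mul_sum]
    refine Finset.sum_lt_sum (fun i _ => ?_) ⟨j, Finset.mem_univ j, ?_⟩
    · nlinarith [hα.nonneg i, hα.le i, le_max_left 0 (1 - y i * (w i + c)),
        le_max_right 0 (1 - y i * (w i + c)),
        mul_nonneg (hα.nonneg i) (sub_nonneg.2 (le_max_right 0 (1 - y i * (w i + c)))),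
        mul_nonneg (sub_nonneg.2 (hα.le i)) (le_max_left 0 (1 - y i * (w i + c)))]
    · by_cases hjA : j ∈ A
      · rw [max_eq_right (hposA j hjA).le]
        exact mul_lt_mul_of_pos_right hjC (hposA j hjA)
      · rw [max_eq_left (hnegA j hjA).le, mul_zero]
        exact mul_neg_of_pos_of_neg hj0 (hnegA j hjA)
  exact absurd (mul_le_mul_of_nonneg_left hmid hC.le) (not_le.2 hstrict)

end Hinge

/-! ### Quaternion matrices, unitarity and stationarity of the trace. -/

section Quaternion

theorem re_mul_comm (a b : ℍ[ℝ]) : (a * b).re = (b * a).re := by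
  simp only [Quaternion.re_mul]; ring

theorem re_sum {ι : Type*} (s : Finset ι) (f : ι → ℍ[ℝ]) : (∑ i ∈ s, f i).re = ∑ i ∈ s, (f i).re :=
  map_sum (AddMonoidHom.mk' (fun a : ℍ[ℝ] => a.re) fun _ _ => rfl) f s

theorem re_trace_mul_comm {ι κ : Type*} [Fintype ι] [Fintype κ] (A : Matrix ι κ ℍ[ℝ])
    (B : Matrix κ ι ℍ[ℝ]) : (A * B).trace.re = (B * A).trace.re := by
  simp only [Matrix.trace, Matrix.diag_apply, Matrix.mul_apply, re_sum]
  rw [Finset.sum_comm]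
  simp only [re_mul_comm]

theorem re_mul_le (a b : ℍ[ℝ]) : (a * b).re ≤ (‖a‖ ^ 2 + ‖b‖ ^ 2) / 2 := by
  have h1 : (a * b).re ≤ ‖a * b‖ := by
    have : ‖a * b‖ ^ 2 = Quaternion.normSq (a * b) := by
      rw [Quaternion.normSq_eq_norm_mul_self, sq]
    refine abs_le_of_sq_le_sq' ?_ (norm_nonneg _) |>.2
    rw [this, Quaternion.normSq_def']
    nlinarith [sq_nonneg (a * b).imI, sq_nonneg (a * b).imJ, sq_nonneg (a * b).imK]
  rw [norm_mul] at h1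
  nlinarith [sq_nonneg (‖a‖ - ‖b‖)]

theorem eq_coe_of_norm_le_re {μ : ℍ[ℝ]} (h : ‖μ‖ ≤ μ.re) : μ = (μ.re : ℍ[ℝ]) := by
  have h1 : Quaternion.normSq μ = ‖μ‖ * ‖μ‖ := Quaternion.normSq_eq_norm_mul_self μ
  rw [Quaternion.normSq_def'] at h1
  have h0 := norm_nonneg μ
  have h2 : ‖μ‖ * ‖μ‖ ≤ μ.re * μ.re := mul_self_le_mul_self h0 h
  have hi : μ.imI = 0 := by nlinarith [sq_nonneg μ.imI, sq_nonneg μ.imJ, sq_nonneg μ.imK]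
  have hj : μ.imJ = 0 := by nlinarith [sq_nonneg μ.imI, sq_nonneg μ.imJ, sq_nonneg μ.imK]
  have hk : μ.imK = 0 := by nlinarith [sq_nonneg μ.imI, sq_nonneg μ.imJ, sq_nonneg μ.imK]
  ext <;> simp [hi, hj, hk]

/-- Unitary quaternion matrices. -/
def IsQUnitary {k : ℕ} (U : QMat k k) : Prop := Uᴴ * U = 1 ∧ U * Uᴴ = 1

variable {k m n : ℕ}

theorem isQUnitary_one : IsQUnitary (1 : QMat k k) := by simp [IsQUnitary]

theorem IsQUnitary.mul {U V : QMat k k} (hU : IsQUnitary U) (hV : IsQUnitary V) :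
    IsQUnitary (U * V) := by
  constructor
  · rw [Matrix.conjTranspose_mul, Matrix.mul_assoc, ← Matrix.mul_assoc Uᴴ, hU.1, Matrix.one_mul,
      hV.1]
  · rw [Matrix.conjTranspose_mul, Matrix.mul_assoc, ← Matrix.mul_assoc V, hV.2, Matrix.one_mul,
      hU.2]

theorem IsQUnitary.conjTranspose {U : QMat k k} (hU : IsQUnitary U) : IsQUnitary Uᴴ := by
  simpa [IsQUnitary] using And.intro hU.2 hU.1

theorem IsQUnitary.sum_col {U : QMat k k} (hU : IsQUnitary U) (j : Fin k) :
    ∑ i, ‖U i j‖ ^ 2 = 1 := by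
  have h := congrArg (fun M : QMat k k => (M j j).re) hU.1
  simp only [Matrix.mul_apply, Matrix.conjTranspose_apply, re_sum, Matrix.one_apply_eq,
    Quaternion.star_mul_self, Quaternion.re_coe, Quaternion.normSq_eq_norm_mul_self] at h
  simpa [sq] using h

theorem IsQUnitary.sum_row {U : QMat k k} (hU : IsQUnitary U) (i : Fin k) :
    ∑ j, ‖U i j‖ ^ 2 = 1 := by
  simpa [Quaternion.norm_star] using hU.conjTranspose.sum_col i

theorem isCompact_isQUnitary : IsCompact {U : QMat k k | IsQUnitary U} := by
  refine IsCompact.of_isClosed_subset (s := Set.univ.pi fun _ : Fin k => Set.univ.pi fun _ : Fin k =>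
    Metric.closedBall (0 : ℍ[ℝ]) 1) ?_ ?_ ?_
  · have : FiniteDimensional ℝ ℍ[ℝ] := inferInstance
    have : ProperSpace ℍ[ℝ] := FiniteDimensional.proper_real _
    exact isCompact_univ_pi fun _ => isCompact_univ_pi fun _ => isCompact_closedBall _ _
  · have h1 : Continuous fun U : QMat k k => Uᴴ * U :=
      continuous_id.matrix_conjTranspose.matrix_mul continuous_id
    have h2 : Continuous fun U : QMat k k => U * Uᴴ :=
      continuous_id.matrix_mul continuous_id.matrix_conjTranspose
    exact (isClosed_eq h1 continuous_const).inter (isClosed_eq h2 continuous_const)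
  · intro U hU i _ j _
    rw [mem_closedBall_zero_iff]
    have h1 := hU.sum_row i
    have h2 : ‖U i j‖ ^ 2 ≤ ∑ j, ‖U i j‖ ^ 2 :=
      Finset.single_le_sum (f := fun j => ‖U i j‖ ^ 2) (fun _ _ => sq_nonneg _) (Finset.mem_univ j)
    rw [h1] at h2
    exact (sq_le_one_iff₀ (norm_nonneg _)).1 h2

/-- The rank-one perturbation of the identity by `v a v*` is unitary when `1 + t a` has modulus one,
where `v* v = t`. -/
theorem isQUnitary_one_add {v : Matrix (Fin k) (Fin 1) ℍ[ℝ]} {t : ℝ} (hv : vᴴ * v = t • 1)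
    {a : Matrix (Fin 1) (Fin 1) ℍ[ℝ]} (ha : a + aᴴ + t • (a * aᴴ) = 0)
    (ha' : a + aᴴ + t • (aᴴ * a) = 0) : IsQUnitary (1 + v * a * vᴴ) := by
  have key : ∀ b c : Matrix (Fin 1) (Fin 1) ℍ[ℝ],
      (1 + v * b * vᴴ) * (1 + v * c * vᴴ) = 1 + v * (b + c + t • (b * c)) * vᴴ := by
    intro b c
    have : v * b * vᴴ * (v * c * vᴴ) = v * (t • (b * c)) * vᴴ := by
      calc v * b * vᴴ * (v * c * vᴴ) = v * b * (vᴴ * v) * c * vᴴ := by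
            simp only [Matrix.mul_assoc]
        _ = _ := by
            rw [hv]
            simp [Matrix.mul_assoc]
    rw [add_mul, mul_add, mul_add, this]
    simp only [Matrix.mul_add, Matrix.add_mul, Matrix.mul_one, Matrix.one_mul]
    abel
  have hct : (1 + v * a * vᴴ)ᴴ = 1 + v * aᴴ * vᴴ := by
    simp [Matrix.conjTranspose_mul, Matrix.mul_assoc]
  constructor
  · rw [hct, key, add_comm aᴴ, ha']; simp
  · rw [hct, key, ha]; simp

/-- If the identity maximizes `G ↦ Re Tr (G M)` over the unitary matrices, then the quadratic form
of `M` is real and nonnegative. -/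
theorem norm_quadratic_le_re {M : QMat k k}
    (hM : ∀ G, IsQUnitary G → (G * M).trace.re ≤ M.trace.re) {v : Matrix (Fin k) (Fin 1) ℍ[ℝ]}
    {t : ℝ} (ht : 0 < t) (hv : vᴴ * v = t • 1) :
    ‖(vᴴ * M * v) 0 0‖ ≤ ((vᴴ * M * v) 0 0).re := by
  set μ := (vᴴ * M * v) 0 0 with hμ
  rcases eq_or_ne μ 0 with h0 | h0
  · simp [h0]
  have hn : 0 < ‖μ‖ := norm_pos_iff.2 h0
  -- ζ is the unit quaternion with ζμ = ‖μ‖. The test matrix 1 + v a v* multiplies the direction of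
  -- v by ζ and changes the trace by (‖μ‖ - Re μ) / t.
  set ζ : ℍ[ℝ] := ‖μ‖⁻¹ • star μ with hζ
  have hζ1 : ζ * star ζ = 1 := by
    rw [Quaternion.self_mul_star, Quaternion.normSq_eq_norm_mul_self, hζ, norm_smul,
      Quaternion.norm_star, norm_inv, norm_norm, inv_mul_cancel₀ hn.ne']
    simp
  have hζ2 : star ζ * ζ = 1 := by
    rw [Quaternion.star_mul_self, ← Quaternion.self_mul_star, hζ1]
  let a : Matrix (Fin 1) (Fin 1) ℍ[ℝ] := Matrix.of fun _ _ => t⁻¹ • (ζ - 1)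
  have hu := isQUnitary_one_add hv (a := a) (by
    refine Matrix.ext fun i j => ?_
    simp only [a, Matrix.add_apply, Matrix.smul_apply, Matrix.mul_apply, Matrix.of_apply,
      Matrix.conjTranspose_apply, Finset.univ_unique, Finset.sum_singleton, Matrix.zero_apply,
      Quaternion.star_smul, star_sub, star_one, smul_mul_smul_comm, smul_smul]
    rw [show t * (t⁻¹ * t⁻¹) = t⁻¹ by field_simp, ← smul_add, ← smul_add]
    rw [sub_mul, mul_sub, hζ1]
    simp) (by
    refine Matrix.ext fun i j => ?_
    simp only [a, Matrix.add_apply, Matrix.smul_apply, Matrix.mul_apply, Matrix.of_apply,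
      Matrix.conjTranspose_apply, Finset.univ_unique, Finset.sum_singleton, Matrix.zero_apply,
      Quaternion.star_smul, star_sub, star_one, smul_mul_smul_comm, smul_smul]
    rw [show t * (t⁻¹ * t⁻¹) = t⁻¹ by field_simp, ← smul_add, ← smul_add]
    rw [sub_mul, mul_sub, hζ2, one_mul, mul_one]
    module)
  have h1 := hM _ hu
  have h2 : (v * a * vᴴ * M).trace.re = t⁻¹ * ((ζ - 1) * μ).re := by
    rw [Matrix.mul_assoc, Matrix.mul_assoc, re_trace_mul_comm, Matrix.mul_assoc]
    rw [hμ]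
    simp [Matrix.trace, a, Matrix.mul_apply (M := a)]
  have h3 : (ζ * μ).re = ‖μ‖ := by
    rw [hζ, smul_mul_assoc, Quaternion.star_mul_self, Quaternion.normSq_eq_norm_mul_self]
    simp
    field_simp
  rw [Matrix.add_mul, Matrix.one_mul, Matrix.trace_add, Quaternion.re_add, h2, sub_mul, one_mul,
    Quaternion.re_sub, h3] at h1
  have h4 : t⁻¹ * (‖μ‖ - μ.re) ≤ 0 := by linarith
  have := nonpos_of_mul_nonpos_right h4 (inv_pos.2 ht)
  linarith

/-- The vectors e_p give the diagonal and e_p + e_q u the rest: with δ = M p q - star (M q p), every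
δu is self-conjugate. Taking u = 1 makes δ real, and u = i makes it zero. -/
theorem isHermitian_of_forall_re_trace_le {M : QMat k k}
    (hM : ∀ G, IsQUnitary G → (G * M).trace.re ≤ M.trace.re) :
    (∀ p, M p p = ((M p p).re : ℍ[ℝ]) ∧ 0 ≤ (M p p).re) ∧ ∀ p q, M p q = star (M q p) := by
  have hdiag : ∀ p, M p p = ((M p p).re : ℍ[ℝ]) ∧ 0 ≤ (M p p).re := by
    intro p
    let v : Matrix (Fin k) (Fin 1) ℍ[ℝ] := Matrix.of fun i _ => if i = p then 1 else 0
    have h := norm_quadratic_le_re hM (v := v) one_pos (by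
      refine Matrix.ext fun i j => ?_
      simp [v, Matrix.mul_apply, Subsingleton.elim i j])
    have e : (vᴴ * M * v) 0 0 = M p p := by
      simp [v, Matrix.mul_apply, apply_ite star]
    rw [e] at h
    exact ⟨eq_coe_of_norm_le_re h, (norm_nonneg _).trans h⟩
  refine ⟨hdiag, fun p q => ?_⟩
  rcases eq_or_ne p q with rfl | hpq
  · rw [(hdiag p).1]; simp
  have hmain : ∀ u : ℍ[ℝ], star ((M p q - star (M q p)) * u) = (M p q - star (M q p)) * u := by
    intro u
    let v : Matrix (Fin k) (Fin 1) ℍ[ℝ] :=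
      Matrix.of fun i _ => (if i = p then 1 else 0) + if i = q then u else 0
    have hnn : 0 ≤ Quaternion.normSq u := Quaternion.normSq_nonneg
    have h := norm_quadratic_le_re hM (t := 1 + Quaternion.normSq u) (v := v) (by linarith) (by
      refine Matrix.ext fun i j => ?_
      simp [v, Matrix.mul_apply, Subsingleton.elim i j, add_mul, mul_add, Finset.sum_add_distrib,
        apply_ite star, hpq, hpq.symm, Quaternion.star_mul_self, Matrix.smul_apply,
        Algebra.smul_def])
    have e : (vᴴ * M * v) 0 0
        = M p p + star u * M q p + (M p q * u + star u * M q q * u) := by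
      simp [v, Matrix.mul_apply, add_mul, mul_add, Finset.sum_add_distrib, apply_ite star]
    rw [e] at h
    have h' := congrArg star (eq_coe_of_norm_le_re h)
    rw [Quaternion.star_coe, ← eq_coe_of_norm_le_re h, (hdiag p).1, (hdiag q).1] at h'
    simp only [star_add, star_mul, star_star, Quaternion.star_coe, ← mul_assoc] at h'
    simp only [sub_mul, star_sub, star_mul, star_star]
    rw [sub_eq_sub_iff_add_eq_add]
    have h2 := add_right_cancel (b := star u * ((M q q).re : ℍ[ℝ]) * u)
      (a := (M p p).re + star (M q p) * u + star u * star (M p q))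
      (c := (M p p).re + star u * M q p + M p q * u) (by
        rw [add_assoc, add_assoc _ (M p q * u)]; exact h')
    rw [add_assoc, add_assoc] at h2
    have h3 := add_left_cancel h2
    rw [add_comm, h3, add_comm]
  have h1 := hmain 1
  obtain ⟨I, hI⟩ : ∃ I : ℍ[ℝ], I.re = 0 ∧ I.imI = 1 ∧ I.imJ = 0 ∧ I.imK = 0 :=
    ⟨⟨0, 1, 0, 0⟩, rfl, rfl, rfl, rfl⟩
  have h2 := hmain I
  rw [← sub_eq_zero]
  generalize M p q - star (M q p) = δ at h1 h2 ⊢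
  have a1 := congrArg (fun x : ℍ[ℝ] => x.imI) h1
  have a2 := congrArg (fun x : ℍ[ℝ] => x.imJ) h1
  have a3 := congrArg (fun x : ℍ[ℝ] => x.imK) h1
  have a4 := congrArg (fun x : ℍ[ℝ] => x.imI) h2
  simp only [mul_one, Quaternion.imI_star, Quaternion.imJ_star, Quaternion.imK_star] at a1 a2 a3 a4
  simp only [Quaternion.imI_mul, hI, mul_one, mul_zero, add_zero, sub_zero] at a4
  ext <;> simp <;> linarith

end Quaternion

/-! ### Singular value decomposition and convexity of the nuclear norm. -/

section SVD

variable {k m n : ℕ}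

theorem rectDiag_mul_apply (σ : ℕ → ℝ) (A : QMat n k) (i : Fin m) (l : Fin k) :
    (rectDiag m n σ * A) i l = if h : (i : ℕ) < n then σ i • A ⟨i, h⟩ l else 0 := by
  rw [Matrix.mul_apply]
  split_ifs with h
  · rw [Finset.sum_eq_single ⟨i, h⟩]
    · simp [rectDiag, Quaternion.coe_mul_eq_smul]
    · intro j _ hj
      have : (i : ℕ) ≠ j := fun e => hj (Fin.ext e.symm)
      simp [rectDiag, this]
    · simp
  · refine Finset.sum_eq_zero fun j _ => ?_
    have : (i : ℕ) ≠ j := fun e => h (e ▸ j.2)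
    simp [rectDiag, this]

theorem conjTranspose_rectDiag (σ : ℕ → ℝ) : (rectDiag m n σ)ᴴ = rectDiag n m σ := by
  refine Matrix.ext fun i j => ?_
  by_cases h : (i : ℕ) = j
  · simp [rectDiag, h]
  · simp [rectDiag, h, Ne.symm h]

theorem mul_rectDiag_apply (σ : ℕ → ℝ) (A : QMat k m) (l : Fin k) (j : Fin n) :
    (A * rectDiag m n σ) l j = if h : (j : ℕ) < m then σ j • A l ⟨j, h⟩ else 0 := by
  have h1 : A * rectDiag m n σ = (rectDiag n m σ * Aᴴ)ᴴ := by
    rw [Matrix.conjTranspose_mul, conjTranspose_rectDiag, Matrix.conjTranspose_conjTranspose]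
  rw [h1, Matrix.conjTranspose_apply, rectDiag_mul_apply]
  split_ifs <;> simp

/-- Every quaternion matrix has a singular value decomposition. -/
theorem exists_isQSVD (A : QMat m n) : ∃ U σ V, IsQSVD A U σ V := by
  -- Any positive weights with distinct squares would do: symmetry of the stationarity conditions on
  -- both sides gives c_j² B_ij = c_i² B_ij, which kills the off-diagonal entries.
  let c : ℕ → ℝ := fun i => ((i : ℝ) + 1)⁻¹
  have hc0 : ∀ i, 0 < c i := fun i => by positivity
  have hcinj : ∀ i j, c i ^ 2 = c j ^ 2 → i = j := by
    intro i j h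
    have := (pow_left_inj₀ (hc0 i).le (hc0 j).le two_ne_zero).1 h
    have := inv_injective this
    exact_mod_cast add_right_cancel this
  -- maximize a weighted sum of the diagonal entries of `U* A V`
  obtain ⟨⟨U, V⟩, ⟨hU, hV⟩, hmax⟩ := (isCompact_isQUnitary (k := m)).prod
    (isCompact_isQUnitary (k := n)) |>.exists_isMaxOn ⟨(1, 1), isQUnitary_one, isQUnitary_one⟩
    (f := fun p : QMat m m × QMat n n => (rectDiag n m c * (p.1ᴴ * A * p.2)).trace.re) (by
      have h1 : Continuous fun p : QMat m m × QMat n n => rectDiag n m c * (p.1ᴴ * A * p.2) :=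
        continuous_const.matrix_mul
          ((continuous_fst.matrix_conjTranspose.matrix_mul continuous_const).matrix_mul
            continuous_snd)
      exact (Quaternion.continuous_re.comp h1.matrix_trace).continuousOn)
  change IsQUnitary U at hU
  change IsQUnitary V at hV
  set B := Uᴴ * A * V with hB
  have hmax' : ∀ (U' : QMat m m) (V' : QMat n n), IsQUnitary U' → IsQUnitary V' →
      (rectDiag n m c * (U'ᴴ * A * V')).trace.re ≤ (rectDiag n m c * B).trace.re :=
    fun U' V' hU' hV' => hmax (a := (U', V')) ⟨hU', hV'⟩
  obtain ⟨hL, hL'⟩ := isHermitian_of_forall_re_trace_le (M := B * rectDiag n m c) (by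
    intro G hG
    have := hmax' (U * Gᴴ) V (hU.mul hG.conjTranspose) hV
    rw [Matrix.conjTranspose_mul, Matrix.conjTranspose_conjTranspose, re_trace_mul_comm,
      re_trace_mul_comm (rectDiag n m c) B] at this
    simpa only [hB, Matrix.mul_assoc] using this)
  obtain ⟨-, hR⟩ := isHermitian_of_forall_re_trace_le (M := rectDiag n m c * B) (by
    intro G hG
    have := hmax' U (V * G) hU (hV.mul hG)
    rw [re_trace_mul_comm]
    simpa only [hB, Matrix.mul_assoc] using this)
  simp only [mul_rectDiag_apply, rectDiag_mul_apply] at hL hL' hR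
  have hoff : ∀ (i : Fin m) (j : Fin n), (i : ℕ) ≠ j → B i j = 0 := by
    intro i j hij
    by_cases hj : (j : ℕ) < m
    · have h1 := hL' i ⟨j, hj⟩
      simp only [j.2, dite_true] at h1
      by_cases hi : (i : ℕ) < n
      · have h2 := hR ⟨i, hi⟩ j
        simp only [hi, hj, i.2, dite_true, Quaternion.star_smul] at h1 h2
        have h3 : (c j ^ 2) • B i j = (c i ^ 2) • B i j := by
          calc (c j ^ 2) • B i j = c j • (c j • B i j) := by rw [smul_smul, sq]
            _ = c i • (c j • star (B ⟨j, hj⟩ ⟨i, hi⟩)) := by rw [h1, smul_comm]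
            _ = (c i ^ 2) • B i j := by rw [← h2, smul_smul, sq]
        rw [← sub_eq_zero, ← sub_smul, smul_eq_zero] at h3
        exact h3.resolve_left fun h => hij (hcinj _ _ (sub_eq_zero.1 h)).symm
      · simp only [hi, dite_false, star_zero] at h1
        exact (smul_eq_zero.1 h1).resolve_left (hc0 _).ne'
    · have hi : (i : ℕ) < n := by omega
      have h2 := hR ⟨i, hi⟩ j
      simp only [hj, i.2, dite_true, dite_false, star_zero] at h2
      exact (smul_eq_zero.1 h2).resolve_left (hc0 _).ne'
  have hdiag : ∀ (i : Fin m) (hi : (i : ℕ) < n),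
      B i ⟨i, hi⟩ = ((B i ⟨i, hi⟩).re : ℍ[ℝ]) ∧ 0 ≤ (B i ⟨i, hi⟩).re := by
    intro i hi
    have h1 := hL i
    simp only [hi, dite_true, Quaternion.re_smul, smul_eq_mul, Quaternion.coe_mul] at h1
    rw [Quaternion.coe_mul_eq_smul] at h1
    exact ⟨smul_right_injective _ (hc0 i).ne' h1.1, nonneg_of_mul_nonneg_right h1.2 (hc0 i)⟩
  refine ⟨U, fun i => if h : i < m ∧ i < n then (B ⟨i, h.1⟩ ⟨i, h.2⟩).re else 0, V,
    hU, hV, fun i => ?_, ?_⟩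
  · split_ifs with h
    · exact (hdiag ⟨i, h.1⟩ h.2).2
    · exact le_rfl
  · have hBd : rectDiag m n (fun i => if h : i < m ∧ i < n then (B ⟨i, h.1⟩ ⟨i, h.2⟩).re else 0)
        = B := by
      refine Matrix.ext fun i j => ?_
      by_cases hij : (i : ℕ) = j
      · have hi : (i : ℕ) < n := hij ▸ j.2
        have hj : j = ⟨i, hi⟩ := Fin.ext hij.symm
        rw [hj, (hdiag i hi).1]
        simp [rectDiag, hi]
      · rw [hoff i j hij]
        simp [rectDiag, hij]
    rw [hBd, hB]
    calc A = (U * Uᴴ) * A * (V * Vᴴ) := by rw [hU.2, hV.2, Matrix.one_mul, Matrix.mul_one]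
      _ = _ := by simp only [Matrix.mul_assoc]

theorem re_trace_mul_rectDiag (σ : ℕ → ℝ) (A : QMat n m) :
    (A * rectDiag m n σ).trace.re = ∑ i ∈ Finset.range (min m n),
      if h : i < m ∧ i < n then σ i * (A ⟨i, h.2⟩ ⟨i, h.1⟩).re else 0 := by
  have h1 : (A * rectDiag m n σ).trace.re = ∑ j : Fin n,
      if h : (j : ℕ) < m ∧ (j : ℕ) < n then σ j * (A ⟨j, h.2⟩ ⟨j, h.1⟩).re else 0 := by
    rw [Matrix.trace, re_sum]
    refine Finset.sum_congr rfl fun j _ => ?_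
    rw [Matrix.diag_apply, mul_rectDiag_apply]
    by_cases h : (j : ℕ) < m <;> simp [h]
  rw [h1, Fin.sum_univ_eq_sum_range (fun j =>
    if h : j < m ∧ j < n then σ j * (A ⟨j, h.2⟩ ⟨j, h.1⟩).re else 0)]
  symm
  refine Finset.sum_subset (Finset.range_subset_range.2 (min_le_right _ _)) fun j _ hj => ?_
  rw [Finset.mem_range, not_lt, min_le_iff] at hj
  exact dif_neg (by omega)

/-- The dual description of the nuclear norm uses the matrices all of whose singular values
are one. -/
noncomputable def isometryMat (U : QMat m m) (V : QMat n n) : QMat m n :=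
  U * rectDiag m n (fun _ => 1) * Vᴴ

/-- After cycling the trace, σ i is multiplied by the real part of a product of a unit row and a
column of norm at most 1, which is at most 1. -/
theorem IsQSVD.re_qInner_le {A : QMat m n} {U σ V} (h : IsQSVD A U σ V) {U' : QMat m m}
    {V' : QMat n n} (hU' : IsQUnitary U') (hV' : IsQUnitary V') :
    (qInner (isometryMat U' V') A).re ≤ ∑ i ∈ Finset.range (min m n), σ i := by
  have hP : IsQUnitary (Vᴴ * V') := (IsQUnitary.conjTranspose h.right_unitary).mul hV'
  have hT : IsQUnitary (U'ᴴ * U) := hU'.conjTranspose.mul h.left_unitary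
  have e : (qInner (isometryMat U' V') A).re
      = ((Vᴴ * V') * (rectDiag n m (fun _ => 1) * (U'ᴴ * U)) * rectDiag m n σ).trace.re := by
    rw [qInner, isometryMat, h.eq, Matrix.conjTranspose_mul, Matrix.conjTranspose_mul,
      conjTranspose_rectDiag, Matrix.conjTranspose_conjTranspose]
    rw [← Matrix.mul_assoc, re_trace_mul_comm]
    simp only [Matrix.mul_assoc]
  rw [e, re_trace_mul_rectDiag]
  refine Finset.sum_le_sum fun i _ => ?_
  split_ifs with hi
  · refine mul_le_of_le_one_right (h.nonneg i) ?_
    have hrow := hP.sum_row ⟨i, hi.2⟩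
    have hcol := hT.sum_col ⟨i, hi.1⟩
    generalize Vᴴ * V' = P at hrow ⊢
    generalize U'ᴴ * U = T at hcol ⊢
    have h1 : (P * (rectDiag n m (fun _ => 1) * T)) ⟨i, hi.2⟩ ⟨i, hi.1⟩
        = ∑ l : Fin n, P ⟨i, hi.2⟩ l * (rectDiag n m (fun _ => 1) * T) l ⟨i, hi.1⟩ :=
      Matrix.mul_apply
    have hcol' : ∑ l : Fin n, ‖(rectDiag n m (fun _ => 1) * T) l ⟨i, hi.1⟩‖ ^ 2 ≤ 1 := by
      let F : ℕ → ℝ := fun l => if h : l < m then ‖T ⟨l, h⟩ ⟨i, hi.1⟩‖ ^ 2 else 0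
      have e1 : ∀ l : Fin n, ‖(rectDiag n m (fun _ => 1) * T) l ⟨i, hi.1⟩‖ ^ 2 = F l := by
        intro l
        rw [rectDiag_mul_apply]
        simp only [F]
        split_ifs <;> simp
      have hF : ∀ l, 0 ≤ F l := fun l => by simp only [F]; split_ifs <;> positivity
      have e2 : ∑ l ∈ Finset.range m, F l = 1 := by
        rw [← Fin.sum_univ_eq_sum_range, ← hcol]
        exact Finset.sum_congr rfl fun l _ => by simp [F]
      simp only [e1]
      rw [Fin.sum_univ_eq_sum_range F, ← e2]
      have e3 : ∑ l ∈ Finset.range n, F l ≤ ∑ l ∈ Finset.range (max m n), F l :=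
        Finset.sum_le_sum_of_subset_of_nonneg
          (Finset.range_subset_range.2 (le_max_right _ _)) fun l _ _ => hF l
      have e4 : ∑ l ∈ Finset.range m, F l = ∑ l ∈ Finset.range (max m n), F l :=
        Finset.sum_subset (Finset.range_subset_range.2 (le_max_left _ _)) fun l _ hl => by
          rw [Finset.mem_range] at hl
          exact dif_neg hl
      rw [e4]; exact e3
    rw [h1, re_sum]
    refine (Finset.sum_le_sum fun l _ => re_mul_le _ _).trans ?_
    rw [← Finset.sum_div, Finset.sum_add_distrib, hrow]
    linarith
  · exact h.nonneg i

theorem IsQSVD.re_qInner_eq {A : QMat m n} {U σ V} (h : IsQSVD A U σ V) :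
    (qInner (isometryMat U V) A).re = ∑ i ∈ Finset.range (min m n), σ i := by
  have e : (qInner (isometryMat U V) A).re
      = (rectDiag n m (fun _ => 1) * rectDiag m n σ).trace.re := by
    rw [qInner, isometryMat, h.eq, Matrix.conjTranspose_mul, Matrix.conjTranspose_mul,
      conjTranspose_rectDiag, Matrix.conjTranspose_conjTranspose, ← Matrix.mul_assoc,
      re_trace_mul_comm]
    calc _ = ((Vᴴ * V) * (rectDiag n m (fun _ => 1) * ((Uᴴ * U) * rectDiag m n σ))).trace.re := by
          simp only [Matrix.mul_assoc]
      _ = _ := by rw [h.left_unitary.1, h.right_unitary.1, Matrix.one_mul, Matrix.one_mul]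
  rw [e, re_trace_mul_rectDiag]
  refine Finset.sum_congr rfl fun i hi => ?_
  rw [Finset.mem_range, lt_min_iff] at hi
  simp [hi, rectDiag]

/-- Each decomposition attains its own sum in the dual pairing and bounds the pairing of any other,
so two decompositions have equal sums. -/
theorem IsQSVD.nuclearNorm_eq {A : QMat m n} {U σ V} (h : IsQSVD A U σ V) :
    nuclearNorm A = ∑ i ∈ Finset.range (min m n), σ i := by
  have : {s : ℝ | ∃ (U : QMat m m) (σ : ℕ → ℝ) (V : QMat n n),
      IsQSVD A U σ V ∧ s = ∑ i ∈ Finset.range (min m n), σ i}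
      = {∑ i ∈ Finset.range (min m n), σ i} := by
    refine Set.eq_singleton_iff_unique_mem.2 ⟨⟨U, σ, V, h, rfl⟩, ?_⟩
    rintro _ ⟨U', σ', V', h', rfl⟩
    refine le_antisymm ?_ ?_
    · rw [← h'.re_qInner_eq]
      exact h.re_qInner_le h'.left_unitary h'.right_unitary
    · rw [← h.re_qInner_eq]
      exact h'.re_qInner_le h.left_unitary h.right_unitary
  rw [nuclearNorm, this, csSup_singleton]

theorem nuclearNorm_nonneg (A : QMat m n) : 0 ≤ nuclearNorm A := by
  obtain ⟨U, σ, V, h⟩ := exists_isQSVD A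
  rw [h.nuclearNorm_eq]
  exact Finset.sum_nonneg fun i _ => h.nonneg i

theorem convexOn_nuclearNorm : ConvexOn ℝ Set.univ (nuclearNorm (m := m) (n := n)) := by
  refine ⟨convex_univ, fun A _ B _ a b ha hb _ => ?_⟩
  obtain ⟨U, σ, V, h⟩ := exists_isQSVD (a • A + b • B)
  obtain ⟨U₁, σ₁, V₁, h₁⟩ := exists_isQSVD A
  obtain ⟨U₂, σ₂, V₂, h₂⟩ := exists_isQSVD B
  rw [h.nuclearNorm_eq, h₁.nuclearNorm_eq, h₂.nuclearNorm_eq, ← h.re_qInner_eq]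
  have e : (qInner (isometryMat U V) (a • A + b • B)).re
      = a * (qInner (isometryMat U V) A).re + b * (qInner (isometryMat U V) B).re := by
    simp [qInner, Matrix.mul_add]
  rw [e]
  exact add_le_add
    (mul_le_mul_of_nonneg_left (h₁.re_qInner_le h.left_unitary h.right_unitary) ha)
    (mul_le_mul_of_nonneg_left (h₂.re_qInner_le h.left_unitary h.right_unitary) hb)

end SVD

/-! ### The quadratic part of the (W, b)-subproblem. -/

section Quadratic

variable {E : Type*} [NormedAddCommGroup E] [InnerProductSpace ℝ E]

open scoped RealInnerProductSpace

/-- The minimizer of the quadratic function in the bound of the `(W, b)`-subproblem by a dual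
certificate. -/
theorem quadratic_le_of_stationary {ρ : ℝ} (hρ : 0 < ρ) {W Z U P : E}
    (hW : W = (1 / (1 + ρ)) • (ρ • Z + U + P)) (W' : E) :
    1 / 2 * ‖W‖ ^ 2 - ⟪P, W⟫ - ⟪U, W - Z⟫ + ρ / 2 * ‖W - Z‖ ^ 2
      ≤ 1 / 2 * ‖W'‖ ^ 2 - ⟪P, W'⟫ - ⟪U, W' - Z⟫ + ρ / 2 * ‖W' - Z‖ ^ 2 := by
  have h0 : (1 + ρ) • W = ρ • Z + U + P := by
    rw [hW, smul_smul, mul_one_div_cancel (by positivity), one_smul]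
  have h1 := congrArg (fun v => ⟪v, W' - W⟫) h0
  simp only [inner_add_left, real_inner_smul_left] at h1
  have h2 := half_sq_norm_add W W'
  have h3 := half_sq_norm_add (W - Z) (W' - Z)
  rw [sub_sub_sub_cancel_right, inner_sub_left] at h3
  have h4 := mul_nonneg (by positivity : 0 ≤ 1 / 2 + ρ / 2) (sq_nonneg ‖W' - W‖)
  have h5 : ⟪U, W' - Z⟫ = ⟪U, W - Z⟫ + ⟪U, W' - W⟫ := by
    rw [← inner_add_right]; congr 1; abel
  have h6 : ⟪P, W'⟫ = ⟪P, W⟫ + ⟪P, W' - W⟫ := by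
    rw [← inner_add_right]; congr 1; abel
  linear_combination h4 - h2 - ρ * h3 + h5 + h6 - h1

end Quadratic

/-! ### The Frobenius inner product and the dual quadratic program. -/

section Frobenius

variable {m n : ℕ}

theorem frobNorm_sq (A : QMat m n) : frobNorm A ^ 2 = ∑ i, ∑ j, ‖A i j‖ ^ 2 :=
  Real.sq_sqrt (Finset.sum_nonneg fun _ _ => Finset.sum_nonneg fun _ _ => sq_nonneg _)

theorem re_qInner_self (A : QMat m n) : (qInner A A).re = frobNorm A ^ 2 := by
  rw [frobNorm_sq, Finset.sum_comm]
  simp only [qInner, Matrix.trace, Matrix.diag_apply, Matrix.mul_apply, re_sum,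
    Matrix.conjTranspose_apply, Quaternion.star_mul_self, Quaternion.re_coe,
    Quaternion.normSq_eq_norm_mul_self, sq]

attribute [local instance] Matrix.frobeniusNormedAddCommGroup Matrix.frobeniusNormedSpace

theorem norm_eq_frobNorm (A : QMat m n) : ‖A‖ = frobNorm A := by
  rw [Matrix.frobenius_norm_def, frobNorm, Real.sqrt_eq_rpow]
  simp

/-- The real inner product `Re ⟨A, B⟩` of quaternion matrices, whose norm is the Frobenius norm. -/
@[reducible] noncomputable def innerProductSpaceQMat : InnerProductSpace ℝ (QMat m n) where
  inner A B := (qInner A B).re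
  norm_sq_eq_re_inner A := by
    rw [norm_eq_frobNorm]; exact (re_qInner_self A).symm
  conj_inner_symm A B := by
    simp only [qInner, Matrix.trace, Matrix.diag_apply, Matrix.mul_apply, re_sum,
      Matrix.conjTranspose_apply, conj_trivial]
    refine Finset.sum_congr rfl fun j _ => Finset.sum_congr rfl fun i _ => ?_
    rw [← Quaternion.re_star]
    simp
  add_left A B M := by simp [qInner, Matrix.add_mul]
  smul_left A B r := by
    have h : (r • A)ᴴ = r • Aᴴ := Matrix.ext fun i j => by simp
    simp [qInner, h]

attribute [local instance] innerProductSpaceQMat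

open scoped RealInnerProductSpace

/-- The proof uses the Frobenius norm; the statement names the entrywise topology, so that it
applies where the norm instance is not active. -/
theorem continuous_of_convexOn_qMat {φ : QMat m n → ℝ} (hφ : ConvexOn ℝ Set.univ φ) :
    Continuous[instTopologicalSpaceMatrix, _] φ :=
  hφ.locallyLipschitz.continuous

variable {N : ℕ} {D : Data m n N}

/-- The values of the linear part of the decision function at the samples. -/
noncomputable def linValues (D : Data m n N) : QMat m n →ₗ[ℝ] (Fin N → ℝ) where
  toFun W i := (qInner W (D.X i)).re
  map_add' A B := by
    funext i; exact inner_add_left A B (D.X i)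
  map_smul' r A := by
    funext i; exact real_inner_smul_left A (D.X i) r

theorem linValues_apply (W : QMat m n) (i : Fin N) : linValues D W i = ⟪W, D.X i⟫ := rfl

theorem inner_sum_smul (W : QMat m n) (β : Fin N → ℝ) :
    ⟪∑ i, β i • D.X i, W⟫ = ∑ i, β i * linValues D W i := by
  rw [sum_inner]
  refine Finset.sum_congr rfl fun i _ => ?_
  rw [real_inner_smul_left, real_inner_comm, linValues_apply]

theorem splitObjective_eq (W : QMat m n) (b : ℝ) (Z : QMat m n) :
    splitObjective D W b Z
      = 1 / 2 * ‖W‖ ^ 2 + D.lam * nuclearNorm Z + D.C * hingeSum D.y (linValues D W) b := by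
  rw [norm_eq_frobNorm]; rfl

theorem augLagrangian_eq (ρ : ℝ) (W : QMat m n) (b : ℝ) (Z U : QMat m n) :
    augLagrangian D ρ W b Z U
      = splitObjective D W b Z - ⟪U, W - Z⟫ + ρ / 2 * ‖W - Z‖ ^ 2 := by
  rw [norm_eq_frobNorm]; rfl

/-- The slack variables can be eliminated from the LSQMM model. -/
theorem isSolution_iff (hC : 0 < D.C) {W : QMat m n} {b : ℝ} :
    IsSolution D W b ↔ ∀ W' b', splitObjective D W b W ≤ splitObjective D W' b' W' := by
  have hfeas : ∀ W' b', IsFeasible D W' b' fun i => max 0 (1 - D.y i * decision D W' b' i) := by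
    intro W' b' i
    refine ⟨?_, le_max_left _ _⟩
    have := le_max_right 0 (1 - D.y i * decision D W' b' i)
    dsimp only
    linarith
  have hle : ∀ W' b' ξ, IsFeasible D W' b' ξ → splitObjective D W' b' W' ≤ objective D W' ξ := by
    intro W' b' ξ hξ
    unfold splitObjective objective
    refine add_le_add_right (mul_le_mul_of_nonneg_left (Finset.sum_le_sum fun i _ => ?_) hC.le) _
    exact max_le (hξ i).2 (by linarith [(hξ i).1])
  constructor
  · rintro ⟨ξ, hξ, hmin⟩ W' b'
    exact (hle W b ξ hξ).trans (hmin W' b' _ (hfeas W' b'))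
  · intro h
    exact ⟨_, hfeas W b, fun W' b' ξ' hξ' => (h W' b').trans (hle W' b' ξ' hξ')⟩

/-- The variational inequality for a solution of the dual quadratic program. -/
theorem IsDualSolution.sum_le {ρ : ℝ} (hρ : 0 < ρ) {Z U W : QMat m n} {α : Fin N → ℝ}
    (hα : IsDualSolution D ρ Z U α)
    (hW : W = (1 / (1 + ρ)) • (ρ • Z + U + ∑ i, (α i * D.y i) • D.X i)) {α' : Fin N → ℝ}
    (hα' : IsDualFeasible D α') :
    ∑ i, (α' i - α i) * (1 - D.y i * linValues D W i) ≤ 0 := by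
  have hρ1 : 1 + ρ ≠ 0 := by positivity
  set P := ∑ i, (α i * D.y i) • D.X i with hP
  set Q := ∑ i, ((α' i - α i) * D.y i) • D.X i with hQ
  set L := ∑ i, (α' i - α i) * (1 - D.y i * linValues D W i) with hL
  have hexp : ∀ t : ℝ, dualObjective D ρ Z U (fun i => α i + t * (α' i - α i))
      = dualObjective D ρ Z U α + t * L - t ^ 2 * (1 / (2 * (1 + ρ)) * ‖Q‖ ^ 2) := by
    intro t
    have h1 : ∑ i, ((α i + t * (α' i - α i)) * D.y i) • D.X i = P + t • Q := by
      rw [hP, hQ, Finset.smul_sum, ← Finset.sum_add_distrib]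
      refine Finset.sum_congr rfl fun i _ => ?_
      rw [smul_smul, ← add_smul]; congr 1; ring
    have h2 : ‖P + t • Q‖ ^ 2 = ‖P‖ ^ 2 + 2 * t * ⟪Q, P⟫ + t ^ 2 * ‖Q‖ ^ 2 := by
      rw [norm_add_sq_real, inner_smul_right, norm_smul, mul_pow, Real.norm_eq_abs, sq_abs,
        real_inner_comm]
      ring
    have h3 : ⟪Q, P⟫ = ∑ i, ((α' i - α i) * D.y i) * linValues D P i := inner_sum_smul P _
    have h4 : ∀ i, linValues D W i
        = 1 / (1 + ρ) * (linValues D (U + ρ • Z) i + linValues D P i) := by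
      intro i
      rw [hW, map_smul, add_comm (ρ • Z) U, map_add]
      rfl
    unfold dualObjective
    rw [h1, ← norm_eq_frobNorm, ← norm_eq_frobNorm, h2, h3, hL]
    have h5 : ∑ i, (1 - D.y i * (qInner (U + ρ • Z) (D.X i)).re / (ρ + 1))
          * (α i + t * (α' i - α i))
        = ∑ i, (1 - D.y i * (qInner (U + ρ • Z) (D.X i)).re / (ρ + 1)) * α i
          + t * (∑ i, (α' i - α i) * (1 - D.y i * linValues D W i)
            + 1 / (1 + ρ) * ∑ i, ((α' i - α i) * D.y i) * linValues D P i) := by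
      rw [Finset.mul_sum, ← Finset.sum_add_distrib, Finset.mul_sum, ← Finset.sum_add_distrib]
      refine Finset.sum_congr rfl fun i _ => ?_
      rw [h4 i, show linValues D (U + ρ • Z) i = (qInner (U + ρ • Z) (D.X i)).re from rfl,
        add_comm ρ 1]
      field_simp
      ring
    rw [h5]
    field_simp
    ring
  have hbound : ∀ t ∈ Set.Ioc (0 : ℝ) 1, L ≤ t * (1 / (2 * (1 + ρ)) * ‖Q‖ ^ 2) := by
    intro t ht
    have h1 := hα.2 (fun i => α i + t * (α' i - α i)) (by
      constructor
      · have : ∑ i, (α i + t * (α' i - α i)) * D.y i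
            = (1 - t) * ∑ i, α i * D.y i + t * ∑ i, α' i * D.y i := by
          rw [Finset.mul_sum, Finset.mul_sum, ← Finset.sum_add_distrib]
          exact Finset.sum_congr rfl fun i _ => by ring
        rw [this, hα.1.1, hα'.1]; simp
      · intro i
        have h1 := hα.1.2 i
        have h2 := hα'.2 i
        constructor <;> nlinarith [ht.1, ht.2])
    rw [hexp] at h1
    refine le_of_mul_le_mul_left (a := t) ?_ ht.1
    linarith
  have hlim : Tendsto (fun t : ℝ => t * (1 / (2 * (1 + ρ)) * ‖Q‖ ^ 2)) (𝓝[>] 0)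
      (𝓝 (0 * (1 / (2 * (1 + ρ)) * ‖Q‖ ^ 2))) :=
    tendsto_nhdsWithin_of_tendsto_nhds (Continuous.tendsto (by fun_prop) 0)
  rw [zero_mul] at hlim
  exact ge_of_tendsto hlim (eventually_of_mem (Ioc_mem_nhdsGT one_pos) hbound)

/-- Complementary slackness: a support matrix determines the bias. -/
theorem IsDualSolution.isBiasCertificate (hy : ∀ i, D.y i = 1 ∨ D.y i = -1)
    {ρ : ℝ} (hρ : 0 < ρ) {Z U W : QMat m n} {α : Fin N → ℝ}
    (hα : IsDualSolution D ρ Z U α)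
    (hW : W = (1 / (1 + ρ)) • (ρ • Z + U + ∑ i, (α i * D.y i) • D.X i)) {j : Fin N}
    (hj0 : 0 < α j) (hjC : α j < D.C) :
    IsBiasCertificate D.C D.y (linValues D W) (D.y j - linValues D W j) α := by
  have hsq : ∀ i, D.y i * D.y i = 1 := fun i => by rcases hy i with h | h <;> rw [h] <;> norm_num
  -- moving the multiplier of `i` by `s` and rebalancing with that of `j`
  have hmove : ∀ i s, 0 ≤ α i + s → α i + s ≤ D.C → |s| ≤ α j → |s| ≤ D.C - α j →
      s * (1 - D.y i * (linValues D W i + (D.y j - linValues D W j))) ≤ 0 := by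
    intro i s h1 h2 h3 h4
    rcases eq_or_ne i j with rfl | hij
    · have : D.y i * (linValues D W i + (D.y i - linValues D W i)) = 1 := by
        rw [add_sub_cancel, hsq]
      rw [this]; simp
    have habs : |s * D.y i * D.y j| = |s| := by
      rw [abs_mul, abs_mul]
      rcases hy i with h | h <;> rcases hy j with h' | h' <;> simp [h, h']
    have h5 := abs_le.1 (habs.le.trans h3)
    have h6 := abs_le.1 (habs.le.trans h4)
    have := hα.sum_le hρ hW
      (α' := fun l => α l + ((Pi.single i s : Fin N → ℝ) l
        - (Pi.single j (s * D.y i * D.y j) : Fin N → ℝ) l)) (by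
        constructor
        · simp only [add_mul, sub_mul, Finset.sum_add_distrib, Finset.sum_sub_distrib, hα.1.1]
          simp only [Pi.single_apply, ite_mul, zero_mul, Finset.sum_ite_eq', Finset.mem_univ,
            if_true]
          rw [mul_assoc (s * D.y i), hsq]; ring
        · intro l
          have hl := hα.1.2 l
          simp only [Pi.single_apply]
          split_ifs with e1 e2 e2
          · exact absurd (e1.symm.trans e2) hij
          · subst e1; constructor <;> linarith
          · subst e2; constructor <;> linarith [h5.1, h5.2, h6.1, h6.2]
          · constructor <;> linarith [hl.1, hl.2])
    simp only [add_sub_cancel_left, sub_mul, Finset.sum_sub_distrib] at this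
    simp only [Pi.single_apply, ite_mul, zero_mul, Finset.sum_ite_eq', Finset.mem_univ,
      if_true] at this
    have e := hsq j
    linear_combination this - (s * D.y i * linValues D W j) * e
  refine ⟨hα.1.1, fun i => (hα.1.2 i).1, fun i => (hα.1.2 i).2, fun i hi => ?_, fun i hi => ?_⟩
  -- The largest shift that lowers α i and keeps α j in [0, C] whichever way it moves.
  · set s := min (α i) (min (α j) (D.C - α j)) with hs
    have hs0 : 0 < s := lt_min hi (lt_min hj0 (sub_pos.2 hjC))
    have hs1 : s ≤ α i := min_le_left _ _
    have hs2 : s ≤ α j := (min_le_right _ _).trans (min_le_left _ _)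
    have hs3 : s ≤ D.C - α j := (min_le_right _ _).trans (min_le_right _ _)
    have := hmove i (-s) (by linarith) (by linarith [(hα.1.2 i).2])
      (by rwa [abs_neg, abs_of_pos hs0]) (by rwa [abs_neg, abs_of_pos hs0])
    rw [neg_mul, neg_nonpos] at this
    exact nonneg_of_mul_nonneg_right this hs0
  · set s := min (D.C - α i) (min (α j) (D.C - α j)) with hs
    have hs0 : 0 < s := lt_min (sub_pos.2 hi) (lt_min hj0 (sub_pos.2 hjC))
    have hs1 : s ≤ D.C - α i := min_le_left _ _
    have hs2 : s ≤ α j := (min_le_right _ _).trans (min_le_left _ _)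
    have hs3 : s ≤ D.C - α j := (min_le_right _ _).trans (min_le_right _ _)
    have := hmove i s (by linarith [(hα.1.2 i).1]) (by linarith)
      (by rwa [abs_of_pos hs0]) (by rwa [abs_of_pos hs0])
    exact nonpos_of_mul_nonpos_right this hs0

/-- A dual certificate proves optimality in the `(W, b)`-subproblem. -/
theorem IsBiasCertificate.augLagrangian_le {ρ : ℝ} (hρ : 0 < ρ) {Z U W : QMat m n} {b : ℝ}
    {α : Fin N → ℝ} (hα : IsBiasCertificate D.C D.y (linValues D W) b α)
    (hW : W = (1 / (1 + ρ)) • (ρ • Z + U + ∑ i, (α i * D.y i) • D.X i)) (W' : QMat m n) (b' : ℝ) :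
    augLagrangian D ρ W b Z U ≤ augLagrangian D ρ W' b' Z U := by
  set P := ∑ i, (α i * D.y i) • D.X i with hP
  have hlin : ∀ V c, ∑ i, α i * (1 - D.y i * (linValues D V i + c)) = ∑ i, α i - ⟪P, V⟫ := by
    intro V c
    rw [hP, inner_sum_smul]
    have : ∑ i, α i * (1 - D.y i * (linValues D V i + c))
        = ∑ i, α i - ∑ i, α i * D.y i * linValues D V i - (∑ i, α i * D.y i) * c := by
      rw [Finset.sum_mul, ← Finset.sum_sub_distrib, ← Finset.sum_sub_distrib]
      exact Finset.sum_congr rfl fun i _ => by ring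
    rw [this, hα.balanced, zero_mul, sub_zero]
  have h1 : D.C * hingeSum D.y (linValues D W) b = ∑ i, α i - ⟪P, W⟫ := by
    rw [← hlin W b, hingeSum, Finset.mul_sum]
    exact Finset.sum_congr rfl fun i _ => hα.mul_max i
  have h2 : ∑ i, α i - ⟪P, W'⟫ ≤ D.C * hingeSum D.y (linValues D W') b' := by
    rw [← hlin W' b', hingeSum, Finset.mul_sum]
    refine Finset.sum_le_sum fun i _ => ?_
    nlinarith [mul_nonneg (hα.nonneg i)
        (sub_nonneg.2 (le_max_right 0 (1 - D.y i * (linValues D W' i + b')))),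
      mul_nonneg (sub_nonneg.2 (hα.le i))
        (le_max_left 0 (1 - D.y i * (linValues D W' i + b')))]
  have h3 := quadratic_le_of_stationary hρ hW W'
  rw [augLagrangian_eq, augLagrangian_eq, splitObjective_eq, splitObjective_eq]
  linarith

end Frobenius

/-! ### Partial minimization over the bias. -/

section HingeMin

variable {N : ℕ}

/-- The hinge loss minimized over the bias. -/
noncomputable def hingeMin (y w : Fin N → ℝ) : ℝ := ⨅ b, hingeSum y w b

theorem hingeMin_eq {y w : Fin N → ℝ} {b : ℝ} (hb : b ∈ hingeArgmin y w) :
    hingeMin y w = hingeSum y w b :=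
  le_antisymm (ciInf_le ⟨0, by rintro _ ⟨c, rfl⟩; exact hingeSum_nonneg y w c⟩ b) (le_ciInf hb)

theorem hingeMin_le (y w : Fin N → ℝ) (b : ℝ) : hingeMin y w ≤ hingeSum y w b :=
  ciInf_le ⟨0, by rintro _ ⟨c, rfl⟩; exact hingeSum_nonneg y w c⟩ b

theorem hingeMin_nonneg (y w : Fin N → ℝ) : 0 ≤ hingeMin y w :=
  le_ciInf fun b => hingeSum_nonneg y w b

/-- The hinge loss is jointly convex in (w, b), so combining minimizing biases of w₁ and w₂ gives an
admissible bias for the combination. -/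
theorem convexOn_hingeMin {y : Fin N → ℝ} (hy : ∀ i, y i = 1 ∨ y i = -1) :
    ConvexOn ℝ Set.univ (hingeMin y) := by
  refine ⟨convex_univ, fun w₁ _ w₂ _ s t hs ht hst => ?_⟩
  obtain ⟨b₁, hb₁⟩ := hingeArgmin_nonempty hy w₁
  obtain ⟨b₂, hb₂⟩ := hingeArgmin_nonempty hy w₂
  refine (hingeMin_le y _ (s * b₁ + t * b₂)).trans ?_
  rw [hingeMin_eq hb₁, hingeMin_eq hb₂, hingeSum, hingeSum, hingeSum, smul_eq_mul, smul_eq_mul,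
    Finset.mul_sum, Finset.mul_sum, ← Finset.sum_add_distrib]
  refine Finset.sum_le_sum fun i _ => ?_
  have e : 1 - y i * ((s • w₁ + t • w₂) i + (s * b₁ + t * b₂))
      = s * (1 - y i * (w₁ i + b₁)) + t * (1 - y i * (w₂ i + b₂)) := by
    simp only [Pi.add_apply, Pi.smul_apply, smul_eq_mul]
    linear_combination - hst
  rw [e]
  exact max_le
    (add_nonneg (mul_nonneg hs (le_max_left _ _)) (mul_nonneg ht (le_max_left _ _)))
    (add_le_add (mul_le_mul_of_nonneg_left (le_max_right _ _) hs)
      (mul_le_mul_of_nonneg_left (le_max_right _ _) ht))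

end HingeMin

/-! ### From saddle points to solutions of the model, and convergence of a run. -/

section Convergence

variable {m n N : ℕ} {D : Data m n N}

attribute [local instance] Matrix.frobeniusNormedAddCommGroup Matrix.frobeniusNormedSpace
  innerProductSpaceQMat

open scoped RealInnerProductSpace

/-- The loss term of the model, minimized over the bias. -/
noncomputable def lossMin (D : Data m n N) (W : QMat m n) : ℝ :=
  D.C * hingeMin D.y (linValues D W)

theorem convexOn_lossMin (hy : ∀ i, D.y i = 1 ∨ D.y i = -1) (hC : 0 ≤ D.C) :
    ConvexOn ℝ Set.univ (lossMin D) :=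
  ((convexOn_hingeMin hy).comp_linearMap (linValues D)).smul hC

theorem lossMin_le (hC : 0 ≤ D.C) (W : QMat m n) (b : ℝ) :
    lossMin D W ≤ D.C * hingeSum D.y (linValues D W) b :=
  mul_le_mul_of_nonneg_left (hingeMin_le _ _ b) hC

section Saddle

variable {x u : QMat m n}

/-- The sum of the two saddle inequalities. The surplus ‖W - x‖² / 2 is what makes the optimal
weight matrix unique. -/
theorem IsSaddle.splitObjective_add_le (hC : 0 ≤ D.C)
    (hs : IsSaddle (lossMin D) (fun Z => D.lam * nuclearNorm Z) x u) (W : QMat m n) (b : ℝ)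
    (Z : QMat m n) :
    lossMin D x + 1 / 2 * ‖x‖ ^ 2 + D.lam * nuclearNorm x + 1 / 2 * ‖W - x‖ ^ 2
      ≤ splitObjective D W b Z - ⟪u, W - Z⟫ := by
  have h1 := hs.left W
  have h2 := hs.right Z
  have h3 := lossMin_le hC W b
  have h4 : ⟪u, W - Z⟫ = ⟪u, W - x⟫ - ⟪u, Z - x⟫ := by
    rw [← inner_sub_right]; congr 1; abel
  rw [splitObjective_eq]
  linarith

theorem splitObjective_of_mem_hingeArgmin {W Z : QMat m n} {b : ℝ}
    (hb : b ∈ hingeArgmin D.y (linValues D W)) :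
    splitObjective D W b Z = lossMin D W + 1 / 2 * ‖W‖ ^ 2 + D.lam * nuclearNorm Z := by
  rw [splitObjective_eq, lossMin, hingeMin_eq hb]; ring

theorem IsSaddle.isSolution_iff (hC : 0 < D.C)
    (hs : IsSaddle (lossMin D) (fun Z => D.lam * nuclearNorm Z) x u) {b : ℝ} :
    IsSolution D x b ↔ b ∈ hingeArgmin D.y (linValues D x) := by
  rw [LSQMM.isSolution_iff hC]
  constructor
  · intro h b'
    have := h x b'
    rw [splitObjective_eq, splitObjective_eq] at this
    exact le_of_mul_le_mul_left (by linarith) hC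
  · intro hb W' b'
    have := hs.splitObjective_add_le hC.le W' b' W'
    rw [sub_self, inner_zero_right, sub_zero] at this
    rw [splitObjective_of_mem_hingeArgmin hb]
    nlinarith [sq_nonneg ‖W' - x‖]

theorem IsSaddle.eq_of_isSolution (hy : ∀ i, D.y i = 1 ∨ D.y i = -1) (hC : 0 < D.C)
    (hs : IsSaddle (lossMin D) (fun Z => D.lam * nuclearNorm Z) x u) {W : QMat m n} {b : ℝ}
    (h : IsSolution D W b) : W = x := by
  rw [LSQMM.isSolution_iff hC] at h
  obtain ⟨b₀, hb₀⟩ := hingeArgmin_nonempty hy (linValues D x)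
  have h1 := h x b₀
  have h2 := hs.splitObjective_add_le hC.le W b W
  rw [sub_self, inner_zero_right, sub_zero] at h2
  rw [splitObjective_of_mem_hingeArgmin hb₀] at h1
  have h3 : ‖W - x‖ ^ 2 ≤ 0 := by linarith
  have h4 : ‖W - x‖ = 0 := pow_eq_zero_iff two_ne_zero |>.1 (le_antisymm h3 (sq_nonneg _))
  exact sub_eq_zero.1 (norm_eq_zero.1 h4)

theorem IsSaddle.augLagrangian_zero_le (hC : 0 ≤ D.C)
    (hs : IsSaddle (lossMin D) (fun Z => D.lam * nuclearNorm Z) x u) {b : ℝ}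
    (hb : b ∈ hingeArgmin D.y (linValues D x)) (W : QMat m n) (b' : ℝ) (Z : QMat m n) :
    augLagrangian D 0 x b x u ≤ augLagrangian D 0 W b' Z u := by
  have := hs.splitObjective_add_le hC W b' Z
  rw [augLagrangian_eq, augLagrangian_eq, splitObjective_of_mem_hingeArgmin hb, sub_self,
    inner_zero_right]
  nlinarith [sq_nonneg ‖W - x‖]

end Saddle

section Run

variable {ρ τ : ℝ} {α : ℕ → Fin N → ℝ} {W : ℕ → QMat m n} {b : ℕ → ℝ} {Z U : ℕ → QMat m n}

theorem mem_supportSet {β : Fin N → ℝ} {i : Fin N} :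
    i ∈ supportSet D β ↔ 0 < β i ∧ β i < D.C := by
  simp [supportSet]

/-- Complementary slackness at one support index gives every support index the same bias value, so
the average equals each of them. -/
theorem IsADMMRun.isBiasCertificate (hrun : IsADMMRun D ρ τ α W b Z U)
    (hy : ∀ i, D.y i = 1 ∨ D.y i = -1) (hρ : 0 < ρ) {k : ℕ}
    (hk : (supportSet D (α (k + 1))).Nonempty) :
    IsBiasCertificate D.C D.y (linValues D (W (k + 1))) (b (k + 1)) (α (k + 1)) := by
  obtain ⟨j, hj⟩ := hk
  have hj' := mem_supportSet.1 hj
  have hcert := (hrun.dual_step k).isBiasCertificate hy hρ (hrun.W_step k) hj'.1 hj'.2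
  have heq : ∀ i ∈ supportSet D (α (k + 1)), D.y i - (qInner (W (k + 1)) (D.X i)).re
      = D.y j - linValues D (W (k + 1)) j := by
    intro i hi
    have hi' := mem_supportSet.1 hi
    have h0 := le_antisymm (hcert.inactive i hi'.2) (hcert.active i hi'.1)
    change D.y i - linValues D (W (k + 1)) i = _
    rcases hy i with h | h <;> rw [h] at h0 ⊢ <;> linarith
  have hb : b (k + 1) = D.y j - linValues D (W (k + 1)) j := by
    have hcard : ((supportSet D (α (k + 1))).card : ℝ) ≠ 0 := by
      exact_mod_cast (Finset.card_pos.2 ⟨j, hj⟩).ne'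
    rw [hrun.b_step k ⟨j, hj⟩, Finset.sum_congr rfl heq, Finset.sum_const, nsmul_eq_mul,
      ← mul_assoc, one_div_mul_cancel hcard, one_mul]
  rw [hb]
  exact hcert

theorem IsADMMRun.augLagrangian_le (hrun : IsADMMRun D ρ τ α W b Z U)
    (hy : ∀ i, D.y i = 1 ∨ D.y i = -1) (hρ : 0 < ρ) (k : ℕ) (W' : QMat m n) (b' : ℝ) :
    augLagrangian D ρ (W (k + 1)) (b (k + 1)) (Z k) (U k)
      ≤ augLagrangian D ρ W' b' (Z k) (U k) := by
  rcases (supportSet D (α (k + 1))).eq_empty_or_nonempty with h | h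
  · exact hrun.b_step_of_empty k h W' b'
  · exact (hrun.isBiasCertificate hy hρ h).augLagrangian_le hρ (hrun.W_step k) W' b'

theorem IsADMMRun.mem_hingeArgmin (hrun : IsADMMRun D ρ τ α W b Z U)
    (hy : ∀ i, D.y i = 1 ∨ D.y i = -1) (hC : 0 < D.C) (hρ : 0 < ρ) (k : ℕ) :
    b (k + 1) ∈ hingeArgmin D.y (linValues D (W (k + 1))) := by
  intro b'
  have := hrun.augLagrangian_le hy hρ k (W (k + 1)) b'
  rw [augLagrangian_eq, augLagrangian_eq, splitObjective_eq, splitObjective_eq] at this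
  exact le_of_mul_le_mul_left (by linarith) hC

theorem IsADMMRun.exists_isSaddle_tendsto (hrun : IsADMMRun D ρ τ α W b Z U)
    (hy : ∀ i, D.y i = 1 ∨ D.y i = -1) (hC : 0 < D.C) (hlam : 0 < D.lam) (hρ : 0 < ρ)
    (hτ : 0 < τ) (hτ' : 0 < 1 + τ - τ ^ 2) :
    ∃ x u, IsSaddle (lossMin D) (fun Z => D.lam * nuclearNorm Z) x u ∧
      Tendsto W atTop (@nhds _ instTopologicalSpaceMatrix x) ∧
      Tendsto Z atTop (@nhds _ instTopologicalSpaceMatrix x) ∧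
      Tendsto U atTop (@nhds _ instTopologicalSpaceMatrix u) := by
  refine admm_tendsto (convexOn_lossMin hy hC.le) ((convexOn_nuclearNorm).smul hlam.le)
    (fun W => mul_nonneg hC.le (hingeMin_nonneg _ _))
    (fun Z => mul_nonneg hlam.le (nuclearNorm_nonneg Z)) hρ hτ hτ' (fun k W' => ?_)
    (fun k Z' => ?_) hrun.U_step
  · obtain ⟨b', hb'⟩ := hingeArgmin_nonempty hy (linValues D W')
    have := hrun.augLagrangian_le hy hρ k W' b'
    rw [augLagrangian_eq, augLagrangian_eq, splitObjective_of_mem_hingeArgmin hb',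
      splitObjective_of_mem_hingeArgmin (hrun.mem_hingeArgmin hy hC hρ k)] at this
    linarith
  · have h := mul_le_mul_of_nonneg_left (hrun.Z_step k Z') hρ.le
    have hcancel : ∀ s t : ℝ, ρ * (D.lam / ρ * s + 1 / 2 * t) = D.lam * s + ρ / 2 * t := by
      intro s t; field_simp
    rw [← norm_eq_frobNorm, ← norm_eq_frobNorm, hcancel, hcancel] at h
    exact h

end Run

end Convergence

theorem continuous_linValues {m n N : ℕ} (D : Data m n N) : Continuous (linValues D) := by
  refine continuous_pi fun i => ?_
  have h : Continuous fun W : QMat m n => (Wᴴ * D.X i).trace :=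
    (continuous_id.matrix_conjTranspose.matrix_mul continuous_const).matrix_trace
  exact Quaternion.continuous_re.comp h

theorem continuous_frobNorm {m n : ℕ} : Continuous (frobNorm (m := m) (n := n)) := by
  refine Real.continuous_sqrt.comp (continuous_finsetSum _ fun i _ =>
    continuous_finsetSum _ fun j _ => ?_)
  exact ((continuous_id.matrix_elem i j).norm).pow 2

end LSQMM

/-! ### The convergence theorem. -/

theorem mainTheorem1 {m n N : ℕ} (D : LSQMM.Data m n N)
    (hy : ∀ i, D.y i = 1 ∨ D.y i = -1) (hC : 0 < D.C) (hlam : 0 < D.lam)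
    (ρ τ : ℝ) (hρ : 0 < ρ) (hτ : 0 < τ) (hτ' : τ ≤ 1.618)
    (α : ℕ → Fin N → ℝ) (W : ℕ → LSQMM.QMat m n) (b : ℕ → ℝ) (Z U : ℕ → LSQMM.QMat m n)
    (hrun : LSQMM.IsADMMRun D ρ τ α W b Z U) :
    ∃ Wopt Uopt : LSQMM.QMat m n,
      -- optimal solutions exist, and `Wopt` is the weight matrix of all of them
      (∃ b', LSQMM.IsSolution D Wopt b') ∧
      (∀ W' b', LSQMM.IsSolution D W' b' → W' = Wopt) ∧
      -- convergence of the matrix iterates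
      Tendsto W atTop (𝓝 Wopt) ∧ Tendsto Z atTop (𝓝 Wopt) ∧ Tendsto U atTop (𝓝 Uopt) ∧
      -- `Uopt` is an optimal Lagrange multiplier, and the objective values converge to the optimum
      (∀ b', LSQMM.IsSolution D Wopt b' →
        (∀ W₁ b₁ Z₁, LSQMM.augLagrangian D 0 Wopt b' Wopt Uopt
          ≤ LSQMM.augLagrangian D 0 W₁ b₁ Z₁ Uopt) ∧
        Tendsto (fun k => LSQMM.splitObjective D (W k) (b k) (Z k)) atTop
          (𝓝 (LSQMM.splitObjective D Wopt b' Wopt))) ∧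
      -- the biases converge to the set of optimal biases
      Tendsto (fun k => Metric.infDist (b k) {b' | LSQMM.IsSolution D Wopt b'}) atTop (𝓝 0) ∧
      -- and to the unique optimal bias if the averaging formula is used infinitely often
      ((∃ᶠ k in atTop, (LSQMM.supportSet D (α (k + 1))).Nonempty) →
        ∃ bopt, Tendsto b atTop (𝓝 bopt) ∧ LSQMM.IsSolution D Wopt bopt ∧
          ∀ b', LSQMM.IsSolution D Wopt b' → b' = bopt) := by
  -- The bound 1.618 lies just below the golden ratio: 1 + 1.618 - 1.618² = 0.000076.
  obtain ⟨x, u, hs, hW, hZ, hU⟩ := hrun.exists_isSaddle_tendsto hy hC hlam hρ hτ (by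
    norm_num at hτ'
    nlinarith)
  obtain ⟨b₀, hb₀⟩ := LSQMM.hingeArgmin_nonempty hy (LSQMM.linValues D x)
  have hB : {b' | LSQMM.IsSolution D x b'} = LSQMM.hingeArgmin D.y (LSQMM.linValues D x) :=
    Set.ext fun _ => hs.isSolution_iff hC
  have hw : Tendsto (fun k => LSQMM.linValues D (W k)) atTop (𝓝 (LSQMM.linValues D x)) :=
    ((LSQMM.continuous_linValues D).tendsto x).comp hW
  have hb : ∀ᶠ k in atTop, b k ∈ LSQMM.hingeArgmin D.y (LSQMM.linValues D (W k)) := by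
    -- The initial bias 0 need not be optimal for `W 0`, hence the start at 1.
    filter_upwards [eventually_ge_atTop 1] with k hk
    obtain ⟨l, rfl⟩ := Nat.exists_eq_succ_of_ne_zero (by omega : k ≠ 0)
    exact hrun.mem_hingeArgmin hy hC hρ l
  have hdist : Tendsto (fun k => Metric.infDist (b k) {b' | LSQMM.IsSolution D x b'}) atTop
      (𝓝 0) := by
    rw [hB]
    exact LSQMM.tendsto_infDist_hingeArgmin hy hw hb
  refine ⟨x, u, ⟨b₀, (hs.isSolution_iff hC).2 hb₀⟩, fun W' b' h => hs.eq_of_isSolution hy hC h,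
    hW, hZ, hU, fun b' hb' => ⟨?_, ?_⟩, hdist, fun hfreq => ?_⟩
  · exact hs.augLagrangian_zero_le hC.le ((hs.isSolution_iff hC).1 hb')
  · rw [LSQMM.splitObjective_of_mem_hingeArgmin ((hs.isSolution_iff hC).1 hb')]
    -- Optimal biases drop out of the objective value, so its convergence needs only continuity in W
    -- and Z, not convergence of `b`.
    have hc1 := LSQMM.continuous_of_convexOn_qMat (LSQMM.convexOn_lossMin hy hC.le)
    have hc2 := LSQMM.continuous_of_convexOn_qMat (LSQMM.convexOn_nuclearNorm (m := m) (n := n))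
    have hlim : Tendsto (fun k => LSQMM.lossMin D (W k) + 1 / 2 * LSQMM.frobNorm (W k) ^ 2
        + D.lam * LSQMM.nuclearNorm (Z k)) atTop (𝓝 (LSQMM.lossMin D x
          + 1 / 2 * LSQMM.frobNorm x ^ 2 + D.lam * LSQMM.nuclearNorm x)) :=
      (((hc1.tendsto x).comp hW).add
        ((((LSQMM.continuous_frobNorm.tendsto x).comp hW).pow 2).const_mul _)).add
        (((hc2.tendsto x).comp hZ).const_mul _)
    rw [LSQMM.norm_eq_frobNorm]
    refine hlim.congr' ?_
    filter_upwards [hb] with k hk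
    rw [LSQMM.splitObjective_of_mem_hingeArgmin hk, LSQMM.norm_eq_frobNorm]
  · have huniq : ∀ b₁ ∈ LSQMM.hingeArgmin D.y (LSQMM.linValues D x),
        ∀ b₂ ∈ LSQMM.hingeArgmin D.y (LSQMM.linValues D x), ¬ b₁ < b₂ := by
      intro b₁ hb₁ b₂ hb₂ hlt
      have hev : ∀ᶠ k in atTop, ∀ i,
          |LSQMM.linValues D (W (k + 1)) i - LSQMM.linValues D x i| < (b₂ - b₁) / 2 := by
        refine eventually_all.2 fun i => ?_
        have h1 := Metric.tendsto_nhds.1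
          ((tendsto_pi_nhds.1 hw i).comp (tendsto_add_atTop_nat 1)) ((b₂ - b₁) / 2) (by linarith)
        exact h1
      obtain ⟨k, hk, hk'⟩ := (hfreq.and_eventually hev).exists
      have hcert := hrun.isBiasCertificate hy hρ hk
      obtain ⟨j, hj⟩ := hk
      have hj' := LSQMM.mem_supportSet.1 hj
      exact LSQMM.not_two_argmin_of_certificate hC hy hlt hb₁ hb₂ hk' hcert j hj'.1 hj'.2
    have huniq' : ∀ b' ∈ LSQMM.hingeArgmin D.y (LSQMM.linValues D x), b' = b₀ := fun b' hb' =>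
      le_antisymm (not_lt.1 (huniq b₀ hb₀ b' hb')) (not_lt.1 (huniq b' hb' b₀ hb₀))
    refine ⟨b₀, ?_, (hs.isSolution_iff hC).2 hb₀, fun b' hb' =>
      huniq' b' ((hs.isSolution_iff hC).1 hb')⟩
    rw [hB, Set.eq_singleton_iff_unique_mem.2 ⟨hb₀, huniq'⟩] at hdist
    simp only [Metric.infDist_singleton] at hdist
    exact tendsto_iff_dist_tendsto_zero.2 hdist
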